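/- Let $\phi\in C^\infty_c(\mathbb R^2)$ be real valued and radially symmetric, with $\operatorname{supp}\phi\subset B(0;1)$ and $\phi\equiv 1$ on $B(0;1/2)$, and put $\omega_0(x)=\phi(x)/|x|$. Let $K(x)=\frac{x^\perp}{2\pi|x|^2}$, $(x_1,x_2)^\perp=(-x_2,x_1)$, be the Biot–Savart kernel and, for $\nu,t>0$, let $\omega_\nu(\cdot,t)=H_\nu(\cdot,t)*\omega_0$ with $H_\nu(x,t)=(4\pi\nu t)^{-1}e^{-|x|^2/(4\nu t)}$. For a radially symmetric Friedrichs mollifier $j$ (smooth, compactly supported, nonnegative, of integral $1$) write $f_\varepsilon=j_\varepsilon*f$ with $j_\varepsilon(x)=\varepsilon^{-2}j(x/\varepsilon)$, and put $$Z_\varepsilon(\omega)=-\nabla\omega_\varepsilon\cdot\big((u\,\omega)_\varepsilon-u_\varepsilon\,\omega_\varepsilon\big),\quad u=K*\omega,\qquad\qquad Z^\nu(\omega_\nu)=\nu|\nabla\omega_\nu|^2 .$$ **Theorem 6.1.** 1. For every $p$ with $4/3\le p<2$: for each $\nu>0$, $\omega_\nu$ is a smooth solution for $t>0$ of the heat equation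 $\partial_t\omega_\nu=\nu\Delta\omega_\nu$ and, with $u_\nu=K*\omega_\nu$, of the two-dimensional Navier–Stokes equations $\partial_t\omega_\nu+u_\nu\cdot\nabla\omega_\nu-\nu\Delta\omega_\nu=0$, attaining the initial vorticity $\omega_0$ in $L^p$ as $t\to0^+$. The time-independent function $\omega_0$ is, for every $T>0$, a weak solution in $L^\infty([0,T);L^p(\mathbb R^2))$ of the two-dimensional Euler equations $\partial_t\omega+u\cdot\nabla\omega=0$, $u=K*\omega$, with initial vorticity $\omega_0$, that is, $u\in L^\infty([0,T);L^2+L^\infty)$ and $$\int_0^T\!\!\int_{\mathbb R^2}\big(\partial_t\psi\,\omega+\nabla\psi\cdot u\,\omega\big)\,dx\,dt+\int_{\mathbb R^2}\psi(x,0)\,\omega_0(x)\,dx=0\qquad\text{for all }\psi\in C_c^\infty([0,T)\times\mathbb R^2),$$ and $\omega_\nu\rightharpoonup\omega_0$ weak-$*$ in $L^\infty([0,T);L^p(\mathbb R^2))$ as $\nu\to0^+$. 2. Both enstrophy defects $Z^T(\omega_0)=\lim_{\varepsilon\to0^+}Z_\varepsilon(\omega_0)$ (for every such $j$) and $Z^V(\omega_0)=\lim_{\nu\to0^+}Z^\nu(\omega_\nu)$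 exist in the sense of distributions on $(0,\infty)\times\mathbb R^2$, and $$Z^T(\omega_0)\equiv0,\qquad Z^V(\omega_0)=\frac{\pi}{2t}\,\delta_0,$$ that is, $\langle Z^V(\omega_0),\psi\rangle=\int_0^\infty\frac{\pi}{2t}\,\psi(t,0)\,dt$ for every test function $\psi$. In particular $Z^T(\omega_0)\ne Z^V(\omega_0)$. 3. For each fixed $t>0$, as $\nu\to0^+$, also $Z^\nu(\omega_\nu)(\cdot,t)\to\frac{\pi}{2t}\,\delta_0$ in $\mathcal D'(\mathbb R^2)$, and $$\|Z^\nu(\omega_\nu)(\cdot,t)\|_{L^1(\mathbb R^2)}=\frac{\pi}{2t}+o(1).$$ -/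

import Mathlib

open MeasureTheory Set Filter Topology TopologicalSpace Metric
open scoped ENNReal NNReal Convolution Gradient Laplacian Distributions

noncomputable section

namespace EnstrophyDefect

/-- The Euclidean plane. -/
abbrev Plane : Type := EuclideanSpace ℝ (Fin 2)

/-- The scalar multiplication `ℝ × F → F` as a bilinear map; `f ⋆[smulBil F, volume] g` is the
convolution `x ↦ ∫ f y • g (x - y) dy` of a scalar function with an `F`-valued one. -/
abbrev smulBil (F : Type*) [NormedAddCommGroup F] [NormedSpace ℝ F] : ℝ →L[ℝ] F →L[ℝ] F :=
  ContinuousLinearMap.lsmul ℝ ℝ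

/-- `(x₁, x₂)^⊥ = (-x₂, x₁)`. -/
def perp (x : Plane) : Plane := !₂[-x 1, x 0]

/-- The Biot-Savart kernel `K(x) = x^⊥ / (2π|x|²)`. -/
def biotSavartKernel (x : Plane) : Plane := (2 * Real.pi * ‖x‖ ^ 2)⁻¹ • perp x

/-- The velocity `u = K ∗ ω` of a vorticity `ω`. -/
def velocity (ω : Plane → ℝ) : Plane → Plane :=
  ω ⋆[smulBil Plane, volume] biotSavartKernel

/-- The integral defining `(K ∗ ω)(x)` converges absolutely. -/
def VelocityExistsAt (ω : Plane → ℝ) (x : Plane) : Prop :=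
  ConvolutionExistsAt ω biotSavartKernel x (smulBil Plane) volume

/-- The space-time slab `(0,T) × ℝ²`. -/
def slab (T : ℝ) : Set (ℝ × Plane) := Ioo 0 T ×ˢ univ

/-- `f ∈ L^∞([0,T); L^p(ℝ²))`. -/
def MemLinftyLp {F : Type*} [NormedAddCommGroup F] (T : ℝ) (p : ℝ≥0∞)
    (f : ℝ → Plane → F) : Prop :=
  AEStronglyMeasurable (fun z : ℝ × Plane => f z.1 z.2) (volume.restrict (slab T)) ∧
    ∃ C : ℝ≥0, ∀ᵐ t ∂(volume.restrict (Ioo 0 T)), eLpNorm (f t) p volume ≤ C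

/-- `ω` is a weak solution, on `[0,T)` and in the class `L^∞([0,T); L^p)` with `p ≥ 4/3`, of the
initial value problem for the 2D incompressible Euler equations in vorticity form
`∂_t ω + u · ∇ω = 0`, `u = K ∗ ω`, with initial vorticity `ω₀`. The test functions in
`C_c^∞([0,T) × ℝ²)` are the restrictions to `t ≥ 0` of smooth functions on `ℝ × ℝ²` with compact
support contained in `(-∞,T) × ℝ²`. -/
structure IsWeakEulerSolution (T : ℝ) (p : ℝ≥0∞) (ω₀ : Plane → ℝ) (ω : ℝ → Plane → ℝ) :
    Prop where
  four_thirds_le : 4 / 3 ≤ p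
  memLp_init : MemLp ω₀ p volume
  mem : MemLinftyLp T p ω
  velocity_exists : ∀ᵐ z ∂(volume.restrict (slab T)), VelocityExistsAt (ω z.1) z.2
  /-- `u ∈ L^∞([0,T); L² + L^∞)`. -/
  velocity_mem : ∃ v w : ℝ → Plane → Plane, MemLinftyLp T 2 v ∧ MemLinftyLp T ∞ w ∧
    ∀ᵐ z ∂(volume.restrict (slab T)), velocity (ω z.1) z.2 = v z.1 z.2 + w z.1 z.2
  weak_form : ∀ ψ : ℝ × Plane → ℝ, ContDiff ℝ (⊤ : ℕ∞) ψ → HasCompactSupport ψ →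
    tsupport ψ ⊆ Iio T ×ˢ univ →
    IntegrableOn (fun z : ℝ × Plane => deriv (fun s => ψ (s, z.2)) z.1 * ω z.1 z.2 +
      inner ℝ (∇ (fun y => ψ (z.1, y)) z.2) (velocity (ω z.1) z.2) * ω z.1 z.2)
      (slab T) volume ∧
    (∫ z in slab T, (deriv (fun s => ψ (s, z.2)) z.1 * ω z.1 z.2 +
      inner ℝ (∇ (fun y => ψ (z.1, y)) z.2) (velocity (ω z.1) z.2) * ω z.1 z.2)) +
      ∫ x, ψ (0, x) * ω₀ x = 0

/-- `ω` is smooth for `t > 0`, bounded in `L^p` locally uniformly in time, and attains the initial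
data `ω₀` strongly in `L^p`. -/
structure IsSmoothEvolution (p : ℝ≥0∞) (ω₀ : Plane → ℝ) (ω : ℝ → Plane → ℝ) : Prop where
  smooth : ContDiffOn ℝ (⊤ : ℕ∞) (fun z : ℝ × Plane => ω z.1 z.2) (Ioi 0 ×ˢ univ)
  mem : ∀ T : ℝ, 0 < T → MemLinftyLp T p ω
  initial : Tendsto (fun t => eLpNorm (ω t - ω₀) p volume) (𝓝[>] 0) (𝓝 0)

/-- `ω` solves the heat equation `∂_t ω = ν Δω` with initial data `ω₀`. -/
structure IsHeatSolution (ν : ℝ) (p : ℝ≥0∞) (ω₀ : Plane → ℝ) (ω : ℝ → Plane → ℝ) : Prop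
    extends IsSmoothEvolution p ω₀ ω where
  heat_eq : ∀ t : ℝ, 0 < t → ∀ x : Plane,
    deriv (fun s => ω s x) t = ν * (Δ (ω t)) x

/-- `ω` solves the 2D incompressible Navier-Stokes equations in vorticity form
`∂_t ω + u · ∇ω - ν Δω = 0`, `u = K ∗ ω`, with initial vorticity `ω₀`. -/
structure IsNavierStokesSolution (ν : ℝ) (p : ℝ≥0∞) (ω₀ : Plane → ℝ) (ω : ℝ → Plane → ℝ) :
    Prop extends IsSmoothEvolution p ω₀ ω where
  velocity_exists : ∀ t : ℝ, 0 < t → ∀ x : Plane, VelocityExistsAt (ω t) x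
  navierStokes_eq : ∀ t : ℝ, 0 < t → ∀ x : Plane,
    deriv (fun s => ω s x) t + inner ℝ (velocity (ω t) x) (∇ (ω t) x) - ν * (Δ (ω t)) x = 0

/-- The family `ω_ν` converges to `ω` weak-∗ in `L^∞([0,T); L^p)`, the dual of
`L¹([0,T); L^q)` with `1/p + 1/q = 1`, as `ν → 0⁺`. -/
def TendstoWeakStar (T : ℝ) (p : ℝ≥0∞) (ων : ℝ → ℝ → Plane → ℝ) (ω : ℝ → Plane → ℝ) : Prop :=
  (∀ᶠ ν in 𝓝[>] (0 : ℝ), MemLinftyLp T p (ων ν)) ∧ MemLinftyLp T p ω ∧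
    ∀ q : ℝ≥0∞, p.HolderConjugate q → ∀ g : ℝ → Plane → ℝ,
      AEStronglyMeasurable (fun z : ℝ × Plane => g z.1 z.2) (volume.restrict (slab T)) →
      ∫⁻ t in Ioo 0 T, eLpNorm (g t) q volume < ∞ →
      Tendsto (fun ν => ∫ z in slab T, ων ν z.1 z.2 * g z.1 z.2) (𝓝[>] 0)
        (𝓝 (∫ z in slab T, ω z.1 z.2 * g z.1 z.2))

/-- `ω` is a viscosity solution of the Euler equations: a weak solution that is the limit, as the
viscosity tends to zero, of the solutions `ω_ν` of the Navier-Stokes equations with the same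
initial vorticity. -/
structure IsViscositySolution (T : ℝ) (p : ℝ≥0∞) (ω₀ : Plane → ℝ) (ων : ℝ → ℝ → Plane → ℝ)
    (ω : ℝ → Plane → ℝ) : Prop where
  euler : IsWeakEulerSolution T p ω₀ ω
  navierStokes : ∀ ν : ℝ, 0 < ν → IsNavierStokesSolution ν p ω₀ (ων ν)
  tendsto : TendstoWeakStar T p ων ω

/-- A radially symmetric Friedrichs mollifier. -/
structure IsRadialMollifier (j : Plane → ℝ) : Prop where
  smooth : ContDiff ℝ (⊤ : ℕ∞) j
  compactSupport : HasCompactSupport j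
  nonneg : ∀ x, 0 ≤ j x
  integral_eq_one : ∫ x, j x = 1
  radial : ∀ x y : Plane, ‖x‖ = ‖y‖ → j x = j y

/-- `j_ε ∗ f`, where `j_ε(x) = ε⁻² j(ε⁻¹ x)`. -/
def mollify {F : Type*} [NormedAddCommGroup F] [NormedSpace ℝ F] (j : Plane → ℝ) (ε : ℝ)
    (f : Plane → F) : Plane → F :=
  (fun x => (ε ^ 2)⁻¹ * j (ε⁻¹ • x)) ⋆[smulBil F, volume] f

/-- The approximate transport enstrophy defect
`Z_ε(ω) = -∇ω_ε · ((u ω)_ε - u_ε ω_ε)` of a vorticity at a fixed time, with `u = K ∗ ω`. -/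
def transportDensity (j : Plane → ℝ) (ε : ℝ) (ω : Plane → ℝ) (x : Plane) : ℝ :=
  -inner ℝ (∇ (mollify j ε ω) x)
    (mollify j ε (fun y => ω y • velocity ω y) x - mollify j ε ω x • mollify j ε (velocity ω) x)

/-- The approximate viscous enstrophy defect `Z^ν(ω) = ν |∇ω|²` of a vorticity at a fixed
time. -/
def viscousDensity (ν : ℝ) (ω : Plane → ℝ) (x : Plane) : ℝ := ν * ‖∇ ω x‖ ^ 2

/-- The locally integrable functions `F i` on the open set `Ω` converge to the distribution `Z`
along `l`, in the sense of distributions on `Ω`. -/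
def TendstoDistribution {E : Type*} [NormedAddCommGroup E] [NormedSpace ℝ E] [MeasureSpace E]
    {ι : Type*} (Ω : Opens E) (F : ι → E → ℝ) (l : Filter ι) (Z : 𝓓'(Ω, ℝ)) : Prop :=
  (∀ᶠ i in l, LocallyIntegrableOn (F i) Ω volume) ∧
    ∀ ψ : 𝓓(Ω, ℝ), Tendsto (fun i => ∫ z in (Ω : Set E), F i z * ψ z) l (𝓝 (Z ψ))

/-- The open set `(0,∞) × ℝ²` of space-time. -/
def spaceTime : Opens (ℝ × Plane) := ⟨Ioi 0 ×ˢ univ, isOpen_Ioi.prod isOpen_univ⟩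

/-- `Z` is the transport enstrophy defect `Z^T(ω) = lim_{ε → 0⁺} Z_ε(ω)`, with respect to the
mollifier `j`. -/
def IsTransportDefect (j : Plane → ℝ) (ω : ℝ → Plane → ℝ) (Z : 𝓓'(spaceTime, ℝ)) : Prop :=
  TendstoDistribution spaceTime (fun (ε : ℝ) z => transportDensity j ε (ω z.1) z.2) (𝓝[>] 0) Z

/-- `Z` is the viscous enstrophy defect `Z^V = lim_{ν → 0⁺} Z^ν(ω_ν)` of the viscosity solution
approximated by the family `ω_ν`. -/
def IsViscousDefect (ων : ℝ → ℝ → Plane → ℝ) (Z : 𝓓'(spaceTime, ℝ)) : Prop :=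
  TendstoDistribution spaceTime (fun (ν : ℝ) z => viscousDensity ν (ων ν z.1) z.2) (𝓝[>] 0) Z

/-- The heat kernel `H_ν(x,t) = (4πνt)⁻¹ exp(-|x|²/(4νt))`. -/
def heatKernel (ν t : ℝ) (x : Plane) : ℝ :=
  (4 * Real.pi * ν * t)⁻¹ * Real.exp (-(‖x‖ ^ 2) / (4 * ν * t))

/-- The heat evolution `H_ν(·,t) ∗ ω₀` of `ω₀` with diffusivity `ν`. -/
def heatEvolution (ω₀ : Plane → ℝ) (ν t : ℝ) : Plane → ℝ :=
  heatKernel ν t ⋆[smulBil ℝ, volume] ω₀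

/-- The vorticity `ω₀(x) = φ(x) / |x|`. -/
def singularVorticity (φ : Plane → ℝ) (x : Plane) : ℝ := φ x / ‖x‖

end EnstrophyDefect

end

open EnstrophyDefect

noncomputable section

namespace EnstrophyDefect

/-! ### Radial symmetry and the Biot-Savart law -/

/-! Everything nonlinear disappears by symmetry. The reflection in the line through `x` fixes `x`,
fixes the gradient of a radial function at `x`, and negates the velocity of a radial vorticity,
because `perp` anticommutes with reflections. Hence `∇f · u = 0` pointwise. This kills the transport
density for every radial mollifier (`transportDensity_eq_zero`) and the advection term of the heat
flow, so the heat solution also solves Navier–Stokes. For the stationary Euler solution, whose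
singularity forbids differentiating it, the same fact is used weakly: integrals against a rotated
test function do not depend on the angle, and differentiating in the angle gives the weak form
(`integral_inner_gradient_velocity_mul`).

The viscous defect survives because `1/|x|` is just outside `L²` and is homogeneous. Write `1/|x| =
2√π ∫ G(α²) dα` with `G` the Gauss kernel (`integral_gaussKernel_sq`). By the semigroup law its heat
flow at time `s` is `2√π ∫ G(α² + s) dα`, so `s |∇|²` is an `L¹`-normalised rescaling of one fixed
profile at scale `√s`. Fubini and polar coordinates give its mass, `∬ (α² + β² + 2)⁻² dα dβ = π/2`
(`integral_enstrophyProfile`). The remainder `(1 - φ)/|x|` is smooth with gradient in `L²`, which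
the heat flow does not increase; its contribution, cross term included, is `O(√s)`
(`integral_abs_viscousDensity_sub_le`).

Since the solution at time `t` is the heat flow at `s = νt`, and `ν = t⁻¹ (νt)`, the mass `π/2` at
the origin becomes `π/(2t)`. Dominated convergence in `t` passes from fixed times to space-time
distributions. -/

@[simp] theorem perp_apply_zero (x : Plane) : perp x 0 = -x 1 := rfl

@[simp] theorem perp_apply_one (x : Plane) : perp x 1 = x 0 := rfl

theorem inner_eq_sum (x y : Plane) : inner ℝ x y = x 0 * y 0 + x 1 * y 1 := by
  rw [PiLp.inner_apply, Fin.sum_univ_two]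
  simp [mul_comm]

theorem norm_sq_eq_sum (x : Plane) : ‖x‖ ^ 2 = x 0 ^ 2 + x 1 ^ 2 := by
  rw [EuclideanSpace.real_norm_sq_eq, Fin.sum_univ_two]

@[simp] theorem norm_perp (x : Plane) : ‖perp x‖ = ‖x‖ := by
  rw [← sq_eq_sq₀ (norm_nonneg _) (norm_nonneg _), norm_sq_eq_sum, norm_sq_eq_sum]
  simp [add_comm]

theorem continuous_perp : Continuous perp := by
  unfold perp
  fun_prop

/-- The linear isometry `A` commutes with `x ↦ x^⊥` up to the factor `σ`. -/
def PerpEquivariant (σ : ℝ) (A : Plane ≃ₗᵢ[ℝ] Plane) : Prop := ∀ x, perp (A x) = σ • A (perp x)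

theorem PerpEquivariant.biotSavartKernel {σ : ℝ} {A : Plane ≃ₗᵢ[ℝ] Plane}
    (hA : PerpEquivariant σ A) (x : Plane) :
    biotSavartKernel (A x) = σ • A (biotSavartKernel x) := by
  simp only [EnstrophyDefect.biotSavartKernel, A.norm_map, hA x, map_smul]
  rw [smul_comm]

/-- Substitute `y ↦ A y`, which preserves Lebesgue measure. This one fact supplies the symmetries of
the velocity, of mollification and of the heat flow. No integrability is needed, since `B` is
invertible and so commutes with the integral even at its default value. -/
theorem convolution_map {F : Type*} [NormedAddCommGroup F] [NormedSpace ℝ F]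
    {A : Plane ≃ₗᵢ[ℝ] Plane} (B : F ≃L[ℝ] F) {f : Plane → ℝ} {v : Plane → F}
    (hf : ∀ x, f (A x) = f x) (hv : ∀ x, v (A x) = B (v x)) (x : Plane) :
    (f ⋆[smulBil F, volume] v) (A x) = B ((f ⋆[smulBil F, volume] v) x) := by
  simp only [convolution]
  rw [← (A.measurePreserving).integral_comp A.toHomeomorph.measurableEmbedding]
  rw [← ContinuousLinearEquiv.integral_comp_comm]
  refine integral_congr_ae (Eventually.of_forall fun y => ?_)
  change f (A y) • v (A x - A y) = B (f y • v (x - y))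
  rw [← map_sub, hv, hf, map_smul]

/-- `σ • A` as a continuous linear equivalence. -/
def scaledIsometry (σ : ℝˣ) (A : Plane ≃ₗᵢ[ℝ] Plane) : Plane ≃L[ℝ] Plane :=
  A.toContinuousLinearEquiv.trans (ContinuousLinearEquiv.smulLeft σ)

theorem PerpEquivariant.velocity {σ : ℝˣ} {A : Plane ≃ₗᵢ[ℝ] Plane} (hA : PerpEquivariant σ A)
    {ω : Plane → ℝ} (hω : ∀ x, ω (A x) = ω x) (x : Plane) :
    velocity ω (A x) = (σ : ℝ) • A (velocity ω x) :=
  convolution_map (scaledIsometry σ A) hω (fun y => hA.biotSavartKernel y) x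

theorem mollify_map {σ : ℝˣ} {A : Plane ≃ₗᵢ[ℝ] Plane} {j : Plane → ℝ} (hj : ∀ x, j (A x) = j x)
    (ε : ℝ) {v : Plane → Plane} (hv : ∀ x, v (A x) = (σ : ℝ) • A (v x)) (x : Plane) :
    mollify j ε v (A x) = (σ : ℝ) • A (mollify j ε v x) :=
  convolution_map (scaledIsometry σ A) (fun y => by rw [← map_smul, hj]) (fun y => hv y) x

theorem mollify_map_scalar {A : Plane ≃ₗᵢ[ℝ] Plane} {j : Plane → ℝ} (hj : ∀ x, j (A x) = j x)
    (ε : ℝ) {f : Plane → ℝ} (hf : ∀ x, f (A x) = f x) (x : Plane) :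
    mollify j ε f (A x) = mollify j ε f x :=
  convolution_map (.refl ℝ ℝ) (fun y => by rw [← map_smul, hj]) (fun y => hf y) x

theorem gradient_map {A : Plane ≃ₗᵢ[ℝ] Plane} {f : Plane → ℝ} (hf : ∀ x, f (A x) = f x)
    (x : Plane) : ∇ f (A x) = A (∇ f x) := by
  have h : f ∘ A = f := funext hf
  have h1 : fderiv ℝ f x = (fderiv ℝ f (A x)).comp (A : Plane →L[ℝ] Plane) := by
    conv_lhs => rw [← h]
    exact A.toContinuousLinearEquiv.comp_right_fderiv
  refine ext_inner_right ℝ fun v => ?_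
  obtain ⟨w, rfl⟩ := A.surjective v
  rw [A.inner_map_map]
  simp only [gradient, InnerProductSpace.toDual_symm_apply]
  rw [h1]
  rfl

/-- Reflections reverse orientation, hence anticommute with the quarter turn `perp`. At `x = 0` any
line will do. -/
theorem exists_perp_reflection (x : Plane) :
    ∃ A : Plane ≃ₗᵢ[ℝ] Plane, PerpEquivariant (-1) A ∧ A x = x := by
  obtain ⟨e, he, hx⟩ : ∃ e : Plane, e ≠ 0 ∧ x ∈ (Submodule.span ℝ {e}) := by
    by_cases hx : x = 0
    · obtain ⟨e, he⟩ := exists_ne (0 : Plane)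
      exact ⟨e, he, by simp [hx]⟩
    · exact ⟨x, hx, Submodule.mem_span_singleton_self x⟩
  refine ⟨(Submodule.span ℝ {e}).reflection, fun z => ?_, Submodule.reflection_eq_self_iff x |>.2 hx⟩
  have hn : e 0 ^ 2 + e 1 ^ 2 ≠ 0 := by
    rw [← norm_sq_eq_sum]; simpa using he
  rw [Submodule.reflection_singleton_apply, Submodule.reflection_singleton_apply]
  ext i
  fin_cases i
  · simp [perp, inner_eq_sum, norm_sq_eq_sum]
    field_simp
    ring
  · simp [perp, inner_eq_sum, norm_sq_eq_sum]
    field_simp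
    ring

/-- Eigenvectors of an isometry for the eigenvalues `1` and `-1` are orthogonal. -/
theorem inner_eq_zero_of_reflection {A : Plane ≃ₗᵢ[ℝ] Plane} {v w : Plane} (hv : A v = v)
    (hw : (-1 : ℝ) • A w = w) : inner ℝ v w = 0 := by
  have h := A.inner_map_map v w
  have h2 : A w = -w := by simpa using congrArg Neg.neg hw
  rw [hv, h2, inner_neg_right] at h
  linarith

/-- A function of `|x|`. -/
def IsRadial (f : Plane → ℝ) : Prop := ∀ x y : Plane, ‖x‖ = ‖y‖ → f x = f y

theorem IsRadial.map {f : Plane → ℝ} (hf : IsRadial f) (A : Plane ≃ₗᵢ[ℝ] Plane) (x : Plane) :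
    f (A x) = f x := hf _ _ (A.norm_map x)

theorem inner_gradient_eq_zero {f : Plane → ℝ} {v : Plane → Plane} (x : Plane)
    (hf : ∀ A : Plane ≃ₗᵢ[ℝ] Plane, ∀ x, f (A x) = f x)
    (hv : ∀ A : Plane ≃ₗᵢ[ℝ] Plane, PerpEquivariant (-1) A → ∀ x, v (A x) = (-1 : ℝ) • A (v x)) :
    inner ℝ (∇ f x) (v x) = 0 := by
  obtain ⟨A, hA, hx⟩ := exists_perp_reflection x
  refine inner_eq_zero_of_reflection (A := A) ?_ ?_
  · rw [← gradient_map (hf A), hx]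
  · rw [← hv A hA, hx]

/-- Both `(uω)_ε` and `u_ε ω_ε` change sign under the reflection while `∇ω_ε` is fixed by it, so the
defect vanishes identically for each `ε`, before any limit. -/
theorem transportDensity_eq_zero {j ω : Plane → ℝ} (hj : IsRadial j) (hω : IsRadial ω) (ε : ℝ)
    (x : Plane) : transportDensity j ε ω x = 0 := by
  have hu : ∀ A : Plane ≃ₗᵢ[ℝ] Plane, PerpEquivariant (-1) A → ∀ x,
      velocity ω (A x) = (-1 : ℝ) • A (velocity ω x) := fun A hA x => by
    have := PerpEquivariant.velocity (σ := -1) (by simpa using hA) (hω.map A) x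
    simpa using this
  have h := inner_gradient_eq_zero (f := mollify j ε ω)
    (v := fun x => mollify j ε (fun y => ω y • velocity ω y) x -
      mollify j ε ω x • mollify j ε (velocity ω) x) x
    (fun A => mollify_map_scalar (hj.map A) ε (hω.map A)) (fun A hA x => by
      rw [mollify_map_scalar (hj.map A) ε (hω.map A)]
      have h1 := mollify_map (σ := -1) (hj.map A) ε (v := velocity ω)
        (by simpa using hu A hA) x
      have h2 := mollify_map (σ := -1) (hj.map A) ε (v := fun y => ω y • velocity ω y)
        (fun y => by simp [hω.map A, hu A hA]) x
      rw [h1, h2]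
      simp only [map_sub, map_smul, Units.val_neg, Units.val_one, neg_smul, one_smul, smul_neg]
      abel)
  unfold transportDensity
  rw [h, neg_zero]

theorem inner_velocity_gradient_eq_zero {ω : Plane → ℝ}
    (hω : ∀ A : Plane ≃ₗᵢ[ℝ] Plane, ∀ x, ω (A x) = ω x) (x : Plane) :
    inner ℝ (velocity ω x) (∇ ω x) = 0 := by
  rw [real_inner_comm]
  refine inner_gradient_eq_zero x hω fun A hA x => ?_
  have := PerpEquivariant.velocity (σ := -1) (by simpa using hA) (hω A) x
  simpa using this

/-- The rotation by the angle `θ`. -/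
def rotation (θ : ℝ) : Plane ≃ₗᵢ[ℝ] Plane :=
  LinearIsometry.toLinearIsometryEquiv
    { toFun := fun x => Real.cos θ • x + Real.sin θ • perp x
      map_add' := fun x y => by
        ext i; fin_cases i <;> (simp [perp]; ring)
      map_smul' := fun c x => by
        ext i; fin_cases i <;> (simp [perp]; ring)
      norm_map' := fun x => by
        rw [← sq_eq_sq₀ (norm_nonneg _) (norm_nonneg _)]
        simp only [LinearMap.coe_mk, AddHom.coe_mk]
        rw [norm_sq_eq_sum, norm_sq_eq_sum]
        simp
        linear_combination (x 0 ^ 2 + x 1 ^ 2) * Real.sin_sq_add_cos_sq θ } rfl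

theorem rotation_apply (θ : ℝ) (x : Plane) :
    rotation θ x = Real.cos θ • x + Real.sin θ • perp x := rfl

theorem perpEquivariant_rotation (θ : ℝ) : PerpEquivariant 1 (rotation θ) := fun x => by
  ext i; fin_cases i <;> simp [rotation_apply, perp] <;> ring

theorem hasDerivAt_rotation (θ : ℝ) (x : Plane) :
    HasDerivAt (fun θ => rotation θ x) (perp (rotation θ x)) θ := by
  have h : perp (rotation θ x) = (-Real.sin θ) • x + Real.cos θ • perp x := by
    ext i; fin_cases i <;> simp [rotation_apply, perp] <;> ring
  rw [h]
  exact ((Real.hasDerivAt_cos θ).smul_const x).add ((Real.hasDerivAt_sin θ).smul_const _)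

/-- The reflection fixing `x` makes the velocity orthogonal to `x`, and in the plane this leaves
only the direction `perp x`. -/
theorem velocity_eq_smul_perp {ω : Plane → ℝ}
    (hω : ∀ A : Plane ≃ₗᵢ[ℝ] Plane, ∀ x, ω (A x) = ω x) (x : Plane) :
    velocity ω x = (inner ℝ (velocity ω x) (perp x) / ‖x‖ ^ 2) • perp x := by
  obtain ⟨A, hA, hx⟩ := exists_perp_reflection x
  have h := PerpEquivariant.velocity (σ := -1) (by simpa using hA) (hω A) x
  rw [hx] at h
  have h0 : inner ℝ x (velocity ω x) = 0 := inner_eq_zero_of_reflection hx (by simpa using h.symm)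
  by_cases hx0 : x = 0
  · subst hx0
    have h3 : perp (0 : Plane) = 0 := by ext i; fin_cases i <;> simp [perp]
    -- At the origin the reflection gives nothing about the direction; the half turn forces
    -- `velocity ω 0 = -velocity ω 0`.
    have := PerpEquivariant.velocity (σ := 1) (A := rotation Real.pi)
      (by simpa using perpEquivariant_rotation _) (hω _) 0
    simp only [map_zero, rotation_apply, Real.cos_pi, Real.sin_pi, Units.val_one, one_smul,
      zero_smul, add_zero, neg_smul] at this
    rw [h3, smul_zero]
    have h2 : (2 : ℝ) • velocity ω 0 = 0 := by rw [two_smul]; exact add_eq_zero_iff_eq_neg.2 this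
    simpa using h2
  · have hn : x 0 ^ 2 + x 1 ^ 2 ≠ 0 := by
      rw [← norm_sq_eq_sum]; simpa using hx0
    rw [inner_eq_sum] at h0
    rw [norm_sq_eq_sum, inner_eq_sum]
    ext i; fin_cases i
    · simp
      field_simp
      linear_combination x 0 * h0
    · simp
      field_simp
      linear_combination x 1 * h0

/-! ### Averages in `L^p` -/

theorem eLpNorm_rpow_eq_lintegral {X F : Type*} [MeasurableSpace X] [NormedAddCommGroup F]
    {ν : Measure X} {p : ℝ≥0∞} (hp : 1 ≤ p) (hp' : p ≠ ∞) (f : X → F) :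
    eLpNorm f p ν ^ p.toReal = ∫⁻ x, ‖f x‖ₑ ^ p.toReal ∂ν := by
  have h0 : p ≠ 0 := (one_pos.trans_le hp).ne'
  have h1 : 0 < p.toReal := ENNReal.toReal_pos h0 hp'
  rw [eLpNorm_eq_lintegral_rpow_enorm_toReal h0 hp', ← ENNReal.rpow_mul,
    one_div_mul_cancel h1.ne', ENNReal.rpow_one]

/-- Jensen's inequality for averages of functions in `L^p`. -/
theorem eLpNorm_integral_rpow_le {X Y F : Type*} [MeasurableSpace X] [MeasurableSpace Y]
    [NormedAddCommGroup F] [NormedSpace ℝ F] {ν : Measure X} {μ : Measure Y} [SFinite ν]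
    [IsProbabilityMeasure μ] {h : X → Y → F}
    (hm : AEStronglyMeasurable (Function.uncurry h) (ν.prod μ)) {p : ℝ≥0∞} (hp : 1 ≤ p)
    (hp' : p ≠ ∞) :
    eLpNorm (fun x => ∫ y, h x y ∂μ) p ν ^ p.toReal ≤
      ∫⁻ y, eLpNorm (fun x => h x y) p ν ^ p.toReal ∂μ := by
  have h0 : p ≠ 0 := (one_pos.trans_le hp).ne'
  have h1 : 0 < p.toReal := ENNReal.toReal_pos h0 hp'
  simp only [eLpNorm_rpow_eq_lintegral hp hp']
  rw [← lintegral_lintegral_swap (by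
    simpa [Function.uncurry_def] using hm.enorm.pow_const p.toReal)]
  refine lintegral_mono_ae ?_
  filter_upwards [hm.prodMk_left] with x hx
  calc ‖∫ y, h x y ∂μ‖ₑ ^ p.toReal ≤ (∫⁻ y, ‖h x y‖ₑ ∂μ) ^ p.toReal := by
        gcongr
        exact enorm_integral_le_lintegral_enorm _
    _ = eLpNorm (h x) 1 μ ^ p.toReal := by rw [eLpNorm_one_eq_lintegral_enorm]
    _ ≤ eLpNorm (h x) p μ ^ p.toReal := by
        gcongr
        exact eLpNorm_le_eLpNorm_of_exponent_le hp hx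
    _ = _ := eLpNorm_rpow_eq_lintegral hp hp' _

/-- Translations form a continuous family of measure-preserving maps, and composition with such a
family is continuous in `L^p` for finite `p`. -/
theorem tendsto_eLpNorm_translate_sub {E : Type*} [NormedAddCommGroup E] [NormedSpace ℝ E]
    [FiniteDimensional ℝ E] [MeasurableSpace E] [BorelSpace E] {μ : Measure E} [μ.IsAddHaarMeasure]
    {f : E → ℝ} {p : ℝ≥0∞} (hp : 1 ≤ p) (hp' : p ≠ ∞) (hf : MemLp f p μ) :
    Tendsto (fun h => eLpNorm (fun x => f (x - h) - f x) p μ) (𝓝 0) (𝓝 0) := by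
  have : Fact (1 ≤ p) := ⟨hp⟩
  let g : E → C(E, E) := fun h => ⟨fun x => x - h, by fun_prop⟩
  have hg : Continuous g := ContinuousMap.continuous_of_continuous_uncurry _ (by
    simp only [g, Function.uncurry_def, ContinuousMap.coe_mk]; fun_prop)
  have hgm : ∀ h, MeasurePreserving (g h) μ μ := fun h => measurePreserving_sub_right μ h
  have hc := (continuous_const (y := hf.toLp f)).compMeasurePreservingLp hg hgm hp'
  have ht := hc.tendsto 0
  rw [tendsto_iff_edist_tendsto_0] at ht
  refine ht.congr fun h => ?_
  rw [Lp.edist_def]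
  refine eLpNorm_congr_ae ?_
  have e1 := Lp.coeFn_compMeasurePreserving (hf.toLp f) (hgm h)
  have e2 := Lp.coeFn_compMeasurePreserving (hf.toLp f) (hgm 0)
  have e3 := (hgm h).quasiMeasurePreserving.ae_eq_comp hf.coeFn_toLp
  have e4 := (hgm 0).quasiMeasurePreserving.ae_eq_comp hf.coeFn_toLp
  filter_upwards [e1, e2, e3, e4] with x h1 h2 h3 h4
  simp only [Pi.sub_apply, h1, h2, h3, h4]
  simp [g]

/-! ### The Gauss kernel -/

/-- The heat kernel of unit diffusivity at time `s`. -/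
def gaussKernel (s : ℝ) (x : Plane) : ℝ :=
  (4 * Real.pi * s)⁻¹ * Real.exp (-(‖x‖ ^ 2) / (4 * s))

theorem heatKernel_eq (ν t : ℝ) : heatKernel ν t = gaussKernel (ν * t) := by
  ext x
  simp only [heatKernel, gaussKernel, mul_assoc]

theorem isRadial_gaussKernel (s : ℝ) : IsRadial (gaussKernel s) := fun x y h => by
  simp [gaussKernel, h]

theorem gaussKernel_pos {s : ℝ} (hs : 0 < s) (x : Plane) : 0 < gaussKernel s x := by
  unfold gaussKernel; positivity

theorem gaussKernel_le {s : ℝ} (hs : 0 < s) (x : Plane) :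
    gaussKernel s x ≤ (4 * Real.pi * s)⁻¹ := by
  unfold gaussKernel
  refine mul_le_of_le_one_right (by positivity) (Real.exp_le_one_iff.2 ?_)
  rw [neg_div]
  exact neg_nonpos.2 (by positivity)

theorem continuous_gaussKernel (s : ℝ) : Continuous (gaussKernel s) := by
  unfold gaussKernel; fun_prop

theorem gaussKernel_scale {s c : ℝ} (hc : 0 < c) (x : Plane) :
    gaussKernel (c ^ 2 * s) (c • x) = (c ^ 2)⁻¹ * gaussKernel s x := by
  unfold gaussKernel
  rw [norm_smul, mul_pow, Real.norm_eq_abs, sq_abs]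
  have : -(c ^ 2 * ‖x‖ ^ 2) / (4 * (c ^ 2 * s)) = -‖x‖ ^ 2 / (4 * s) := by
    rw [show -(c ^ 2 * ‖x‖ ^ 2) = c ^ 2 * (-‖x‖ ^ 2) by ring,
      show 4 * (c ^ 2 * s) = c ^ 2 * (4 * s) by ring, mul_div_mul_left _ _ (by positivity)]
  rw [this]
  rw [show 4 * Real.pi * (c ^ 2 * s) = c ^ 2 * (4 * Real.pi * s) by ring, mul_inv, mul_assoc]

theorem integral_exp_neg_mul_norm_sq {b : ℝ} (hb : 0 < b) :
    ∫ x : Plane, Real.exp (-b * ‖x‖ ^ 2) = Real.pi / b := by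
  rw [GaussianFourier.integral_rexp_neg_mul_sq_norm hb]
  simp

theorem integral_gaussKernel {s : ℝ} (hs : 0 < s) : ∫ x, gaussKernel s x = 1 := by
  unfold gaussKernel
  rw [integral_const_mul]
  have : ∀ x : Plane, -‖x‖ ^ 2 / (4 * s) = -(4 * s)⁻¹ * ‖x‖ ^ 2 := fun x => by
    field_simp
  simp only [this]
  rw [integral_exp_neg_mul_norm_sq (by positivity)]
  have := Real.pi_pos
  field_simp

theorem integrable_gaussKernel {s : ℝ} (hs : 0 < s) : Integrable (gaussKernel s) :=
  -- The Bochner integral of a non-integrable function is `0`, so a nonzero value certifies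
  -- integrability. The same device recurs below.
  .of_integral_ne_zero (by rw [integral_gaussKernel hs]; exact one_ne_zero)

/-- The Gauss measure with density `gaussKernel s`. -/
def gaussMeasure (s : ℝ) : Measure Plane :=
  volume.withDensity fun x => ENNReal.ofReal (gaussKernel s x)

theorem isProbabilityMeasure_gaussMeasure {s : ℝ} (hs : 0 < s) :
    IsProbabilityMeasure (gaussMeasure s) := by
  refine ⟨?_⟩
  rw [gaussMeasure, withDensity_apply _ MeasurableSet.univ, Measure.restrict_univ]
  rw [← ofReal_integral_eq_lintegral_ofReal (integrable_gaussKernel hs)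
    (Eventually.of_forall fun x => (gaussKernel_pos hs x).le), integral_gaussKernel hs,
    ENNReal.ofReal_one]

theorem gaussMeasure_absolutelyContinuous (s : ℝ) : gaussMeasure s ≪ volume :=
  withDensity_absolutelyContinuous _ _

section

variable {F : Type*} [NormedAddCommGroup F] [NormedSpace ℝ F]

theorem measurable_ofReal_gaussKernel (s : ℝ) :
    Measurable fun x => ENNReal.ofReal (gaussKernel s x) :=
  (continuous_gaussKernel s).measurable.ennreal_ofReal

theorem integral_gaussMeasure {s : ℝ} (hs : 0 < s) (f : Plane → F) :
    ∫ y, f y ∂(gaussMeasure s) = ∫ y, gaussKernel s y • f y := by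
  rw [gaussMeasure, integral_withDensity_eq_integral_toReal_smul
    (measurable_ofReal_gaussKernel s) (Eventually.of_forall fun x => by simp)]
  simp only [ENNReal.toReal_ofReal (gaussKernel_pos hs _).le]

theorem integrable_gaussMeasure {s : ℝ} (hs : 0 < s) (f : Plane → F) :
    Integrable f (gaussMeasure s) ↔ Integrable (fun y => gaussKernel s y • f y) := by
  rw [gaussMeasure, integrable_withDensity_iff_integrable_smul'
    (measurable_ofReal_gaussKernel s) (Eventually.of_forall fun x => by simp)]
  simp only [ENNReal.toReal_ofReal (gaussKernel_pos hs _).le]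

/-- The heat semigroup. -/
def heatFlow (s : ℝ) (f : Plane → F) : Plane → F := gaussKernel s ⋆[smulBil F, volume] f

theorem heatFlow_apply (s : ℝ) (f : Plane → F) (x : Plane) :
    heatFlow s f x = ∫ y, gaussKernel s y • f (x - y) := rfl

theorem heatFlow_apply' (s : ℝ) (f : Plane → F) (x : Plane) :
    heatFlow s f x = ∫ y, gaussKernel s (x - y) • f y := by
  rw [heatFlow_apply, ← integral_sub_left_eq_self _ volume x]
  simp

theorem heatEvolution_eq (f : Plane → ℝ) (ν t : ℝ) :
    heatEvolution f ν t = heatFlow (ν * t) f := by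
  rw [heatEvolution, heatKernel_eq]; rfl

theorem heatFlow_eq_integral {s : ℝ} (hs : 0 < s) (f : Plane → F) (x : Plane) :
    heatFlow s f x = ∫ y, f (x - y) ∂(gaussMeasure s) := by
  rw [integral_gaussMeasure hs, heatFlow_apply]

/-- After rescaling, one probability measure serves all times and `s` enters only through the
translation, which prepares dominated convergence as `s → 0`. -/
theorem heatFlow_eq_integral_scaled {s : ℝ} (hs : 0 < s) (f : Plane → F) (x : Plane) :
    heatFlow s f x = ∫ z, f (x - √s • z) ∂(gaussMeasure 1) := by
  have hc : 0 < √s := Real.sqrt_pos.2 hs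
  rw [integral_gaussMeasure one_pos, heatFlow_apply]
  have h := Measure.integral_comp_smul (volume : Measure Plane)
    (fun y => gaussKernel s y • f (x - y)) (√s)
  have h2 : ∀ z : Plane, gaussKernel s (√s • z) = s⁻¹ * gaussKernel 1 z := fun z => by
    have := gaussKernel_scale (s := 1) hc z
    rwa [Real.sq_sqrt hs.le, mul_one] at this
  simp only [h2, mul_smul, integral_smul] at h
  rw [finrank_euclideanSpace_fin, Real.sq_sqrt hs.le, abs_of_pos (by positivity)] at h
  exact (smul_right_injective F (inv_ne_zero hs.ne') h).symm

/-- The heat flow averages translates of `f`, all of the same norm; apply Jensen. -/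
theorem eLpNorm_heatFlow_le {s : ℝ} (hs : 0 < s) {f : Plane → F} {p : ℝ≥0∞} (hp : 1 ≤ p)
    (hp' : p ≠ ∞) (hf : AEStronglyMeasurable f volume) :
    eLpNorm (heatFlow s f) p volume ≤ eLpNorm f p volume := by
  have := isProbabilityMeasure_gaussMeasure hs
  have h1 : 0 < p.toReal := ENNReal.toReal_pos (one_pos.trans_le hp).ne' hp'
  rw [← ENNReal.rpow_le_rpow_iff h1]
  have hfe : heatFlow s f = fun x => ∫ y, f (x - y) ∂(gaussMeasure s) :=
    funext (heatFlow_eq_integral hs f)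
  rw [hfe]
  refine (eLpNorm_integral_rpow_le (h := fun x y => f (x - y)) ?_ hp hp').trans ?_
  · refine AEStronglyMeasurable.mono_ac
      (Measure.AbsolutelyContinuous.rfl.prod (gaussMeasure_absolutelyContinuous s)) ?_
    exact hf.comp_quasiMeasurePreserving (quasiMeasurePreserving_sub_of_right_invariant volume volume)
  · have : ∀ y, eLpNorm (fun x => f (x - y)) p volume = eLpNorm f p volume := fun y =>
      eLpNorm_comp_measurePreserving hf (measurePreserving_sub_right volume y)
    simp [this]

end

/-- By Jensen the error is at most the Gaussian average of translation errors. These tend to `0` for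
each fixed `z`, with `p`-th power dominated by `(2 ‖f‖_p)^p`. -/
theorem tendsto_eLpNorm_heatFlow_sub {f : Plane → ℝ} {p : ℝ≥0∞} (hp : 1 ≤ p)
    (hp' : p ≠ ∞) (hf : MemLp f p volume) (hi : Integrable f) :
    Tendsto (fun s => eLpNorm (heatFlow s f - f) p volume) (𝓝[>] 0) (𝓝 0) := by
  have := isProbabilityMeasure_gaussMeasure one_pos
  have h1 : 0 < p.toReal := ENNReal.toReal_pos (one_pos.trans_le hp).ne' hp'
  have hmeas : ∀ s : ℝ, 0 < s → AEStronglyMeasurable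
      (Function.uncurry fun (x z : Plane) => f (x - √s • z) - f x)
      (volume.prod (gaussMeasure 1)) := fun s hs => by
    refine AEStronglyMeasurable.mono_ac
      (Measure.AbsolutelyContinuous.rfl.prod (gaussMeasure_absolutelyContinuous 1)) ?_
    refine AEStronglyMeasurable.sub ?_ hf.1.comp_fst
    have h3 : Measure.QuasiMeasurePreserving (fun q : Plane × Plane => q.1 - √s • q.2)
        (volume.prod volume) volume :=
      QuasiMeasurePreserving.prod_of_left (by fun_prop) (Eventually.of_forall fun z =>
        (measurePreserving_sub_right volume (√s • z)).quasiMeasurePreserving)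
    exact hf.1.comp_quasiMeasurePreserving h3
  have hkey : ∀ s : ℝ, 0 < s → eLpNorm (heatFlow s f - f) p volume ^ p.toReal ≤
      ∫⁻ z, eLpNorm (fun x => f (x - √s • z) - f x) p volume ^ p.toReal ∂(gaussMeasure 1) := by
    intro s hs
    have hfe : heatFlow s f - f = fun x => ∫ z, (f (x - √s • z) - f x) ∂(gaussMeasure 1) := by
      ext x
      rw [integral_sub _ (integrable_const _), Pi.sub_apply, heatFlow_eq_integral_scaled hs]
      · simp
      · rw [integrable_gaussMeasure one_pos]
        refine Integrable.bdd_mul (c := (4 * Real.pi * 1)⁻¹) ?_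
          (continuous_gaussKernel 1).aestronglyMeasurable (Eventually.of_forall fun y => ?_)
        · exact (hi.comp_sub_left x).comp_smul (Real.sqrt_pos.2 hs).ne'
        · rw [Real.norm_of_nonneg (gaussKernel_pos one_pos y).le]
          exact gaussKernel_le one_pos y
    rw [hfe]
    exact eLpNorm_integral_rpow_le (hmeas s hs) hp hp'
  have hlim : Tendsto (fun s => ∫⁻ z, eLpNorm (fun x => f (x - √s • z) - f x) p volume ^ p.toReal
      ∂(gaussMeasure 1)) (𝓝[>] 0) (𝓝 (∫⁻ _, 0 ∂(gaussMeasure 1))) := by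
    refine tendsto_lintegral_filter_of_dominated_convergence'
      (fun _ => (2 * eLpNorm f p volume) ^ p.toReal) ?_ ?_ ?_ ?_
    · filter_upwards [self_mem_nhdsWithin] with s hs
      simp only [eLpNorm_rpow_eq_lintegral hp hp']
      exact ((hmeas s hs).prod_swap.enorm.pow_const p.toReal).lintegral_prod_right'
    · refine Eventually.of_forall fun s => Eventually.of_forall fun z => ?_
      have hm := (measurePreserving_sub_right (volume : Measure Plane) (√s • z))
      gcongr
      refine (eLpNorm_sub_le (hf.1.comp_measurePreserving hm) hf.1 hp).trans ?_
      rw [two_mul]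
      gcongr
      exact (eLpNorm_comp_measurePreserving hf.1 hm).le
    · simp only [lintegral_const, measure_univ, mul_one]
      exact ENNReal.rpow_ne_top_of_nonneg h1.le (ENNReal.mul_ne_top (by simp) hf.2.ne)
    · refine Eventually.of_forall fun z => ?_
      have hs : Tendsto (fun s : ℝ => √s • z) (𝓝[>] 0) (𝓝 0) := by
        have : Continuous fun s : ℝ => √s • z := by fun_prop
        simpa using (this.tendsto 0).mono_left nhdsWithin_le_nhds
      have := ((tendsto_eLpNorm_translate_sub hp hp' hf).comp hs).ennrpow_const p.toReal
      simpa [ENNReal.zero_rpow_of_pos h1] using this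
  rw [lintegral_zero] at hlim
  have h2 : Tendsto (fun s => eLpNorm (heatFlow s f - f) p volume ^ p.toReal) (𝓝[>] 0) (𝓝 0) :=
    tendsto_of_tendsto_of_tendsto_of_le_of_le' tendsto_const_nhds hlim
      (Eventually.of_forall fun _ => zero_le) (by
        filter_upwards [self_mem_nhdsWithin] with s hs using hkey s hs)
  have h3 := h2.ennrpow_const (p.toReal)⁻¹
  rw [ENNReal.zero_rpow_of_pos (inv_pos.2 h1)] at h3
  refine h3.congr fun s => ?_
  rw [← ENNReal.rpow_mul, mul_inv_cancel₀ h1.ne', ENNReal.rpow_one]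

/-! ### Smoothness of the heat flow and the heat equation -/

theorem contDiffOn_gaussKernel {n : WithTop ℕ∞} :
    ContDiffOn ℝ n (fun z : ℝ × Plane => gaussKernel z.1 z.2) (Ioi 0 ×ˢ univ) := by
  have h : ∀ z ∈ (Ioi 0 ×ˢ univ : Set (ℝ × Plane)), 4 * Real.pi * z.1 ≠ 0 := fun z hz => by
    have h1 : 0 < z.1 := hz.1
    positivity
  have h' : ∀ z ∈ (Ioi 0 ×ˢ univ : Set (ℝ × Plane)), 4 * z.1 ≠ 0 := fun z hz => by
    have h1 : 0 < z.1 := hz.1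
    positivity
  unfold gaussKernel
  refine ContDiffOn.mul ?_ (ContDiffOn.exp ?_)
  · exact (contDiffOn_const.mul contDiff_fst.contDiffOn).inv h
  · exact (contDiff_snd.norm_sq ℝ).neg.contDiffOn.div
      (contDiffOn_const.mul contDiff_fst.contDiffOn) h'

/-- For `x` near `x₀` only `y` in a fixed ball contribute, because `f` has compact support. There
the Gauss kernel may be replaced by a compactly supported cutoff of it, to which smoothness of
convolutions with parameters applies. -/
theorem contDiffOn_heatFlow {f : Plane → ℝ} (hi : Integrable f) (hf : HasCompactSupport f) :
    ContDiffOn ℝ (⊤ : ℕ∞) (fun z : ℝ × Plane => heatFlow z.1 f z.2) (Ioi 0 ×ˢ univ) := by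
  obtain ⟨ρ, hρ, hsupp⟩ := hf.isCompact.isBounded.exists_pos_norm_le
  have hopen : IsOpen (Ioi 0 ×ˢ univ : Set (ℝ × Plane)) := isOpen_Ioi.prod isOpen_univ
  rintro ⟨t, x₀⟩ hz
  have hR : 0 < ‖x₀‖ + 1 + ρ := by positivity
  -- If `‖x - x₀‖ < 1` and `‖x - y‖ ≤ ρ` then `‖y‖ ≤ ‖x₀‖ + 1 + ρ`.
  let χ : ContDiffBump (0 : Plane) := ⟨‖x₀‖ + 1 + ρ, ‖x₀‖ + 1 + ρ + 1, hR, by linarith⟩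
  have hsm := contDiffOn_convolution_left_with_param (μ := volume) (n := ⊤)
    (smulBil ℝ) (f := f) (g := fun (s : ℝ) y => χ y * gaussKernel s y) (s := Ioi 0)
    (k := closedBall 0 (‖x₀‖ + 1 + ρ + 1)) isOpen_Ioi (isCompact_closedBall _ _)
    (fun s y _ hy => by
      rw [χ.zero_of_le_dist (by simpa [χ] using (not_le.1 (fun h => hy (by simpa using h))).le), zero_mul])
    hi.locallyIntegrable
    ((χ.contDiff.comp contDiff_snd).contDiffOn.mul contDiffOn_gaussKernel)
  refine ((hsm.contDiffAt (hopen.mem_nhds hz)).congr_of_eventuallyEq ?_).contDiffWithinAt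
  have hnhds : (univ ×ˢ ball x₀ 1 : Set (ℝ × Plane)) ∈ 𝓝 (t, x₀) :=
    (isOpen_univ.prod isOpen_ball).mem_nhds ⟨mem_univ _, mem_ball_self one_pos⟩
  filter_upwards [hnhds] with z hz'
  refine integral_congr_ae (Eventually.of_forall fun y => ?_)
  change gaussKernel z.1 y * f (z.2 - y) = (χ y * gaussKernel z.1 y) * f (z.2 - y)
  by_cases hy : z.2 - y ∈ tsupport f
  · have h1 := hsupp _ hy
    have h2 : ‖z.2 - x₀‖ < 1 := by simpa [dist_eq_norm] using hz'.2
    have h3 : ‖y‖ ≤ ‖x₀‖ + 1 + ρ := by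
      calc ‖y‖ = ‖x₀ + (z.2 - x₀) - (z.2 - y)‖ := by congr 1; abel
        _ ≤ ‖x₀ + (z.2 - x₀)‖ + ‖z.2 - y‖ := norm_sub_le _ _
        _ ≤ ‖x₀‖ + ‖z.2 - x₀‖ + ‖z.2 - y‖ := by gcongr; exact norm_add_le _ _
        _ ≤ _ := by linarith
    rw [χ.one_of_mem_closedBall (by simpa [χ] using h3), one_mul]
  · rw [image_eq_zero_of_notMem_tsupport hy, mul_zero, mul_zero]

theorem contDiff_heatFlow {f : Plane → ℝ} (hi : Integrable f) (hf : HasCompactSupport f)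
    {s : ℝ} (hs : 0 < s) : ContDiff ℝ (⊤ : ℕ∞) (heatFlow s f) := by
  have := (contDiffOn_heatFlow hi hf).comp (t := Ioi 0 ×ˢ univ) (s := univ)
    (f := fun x : Plane => (s, x)) (contDiff_const.prodMk contDiff_id).contDiffOn
    (fun x _ => ⟨hs, mem_univ _⟩)
  exact contDiffOn_univ.1 this

/-- Used in two ways: with `k` the Gauss kernel or one of its derivatives and `f` the singular
vorticity, and with `k` the smooth part and `f` the Gauss kernel, so that the derivative can fall on
either factor. -/
theorem hasFDerivAt_integral_mul_translate {E : Type*} [NormedAddCommGroup E] [NormedSpace ℝ E]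
    [FiniteDimensional ℝ E] [MeasurableSpace E] [BorelSpace E] {μ : Measure E}
    {k f : E → ℝ} (hk : ContDiff ℝ 1 k) {C C' : ℝ}
    (hC : ∀ x, ‖k x‖ ≤ C) (hC' : ∀ x, ‖fderiv ℝ k x‖ ≤ C') (hf : Integrable f μ) (x : E) :
    HasFDerivAt (fun x => ∫ y, f y * k (x - y) ∂μ) (∫ y, f y • fderiv ℝ k (x - y) ∂μ) x := by
  have hk' : Continuous (fderiv ℝ k) := hk.continuous_fderiv one_ne_zero
  refine hasFDerivAt_integral_of_dominated_of_fderiv_le (𝕜 := ℝ) (s := univ)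
    (F := fun x y => f y * k (x - y)) (F' := fun x y => f y • fderiv ℝ k (x - y))
    (bound := fun y => ‖f y‖ * C')
    univ_mem (Eventually.of_forall fun x => ?_) ?_ ?_ (Eventually.of_forall fun y z _ => ?_)
    (hf.norm.mul_const C') (Eventually.of_forall fun y z _ => ?_)
  · exact hf.1.mul (hk.continuous.comp (by fun_prop)).aestronglyMeasurable
  · exact hf.mul_bdd (hk.continuous.comp (by fun_prop)).aestronglyMeasurable
      (Eventually.of_forall fun y => hC _)
  · exact hf.1.smul (hk'.comp (by fun_prop)).aestronglyMeasurable
  · rw [norm_smul]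
    gcongr
    exact hC' _
  · have h1 : HasFDerivAt (fun x => k (x - y)) (fderiv ℝ k (z - y)) z := by
      have := (hk.differentiable one_ne_zero (z - y)).hasFDerivAt.comp z
        ((hasFDerivAt_id z).sub_const y)
      simpa [Function.comp_def] using this
    exact h1.const_mul (f y)

/-! ### Derivatives of the Gauss kernel and of the heat flow -/

theorem contDiff_gaussKernel (s : ℝ) {n : WithTop ℕ∞} : ContDiff ℝ n (gaussKernel s) := by
  unfold gaussKernel
  exact contDiff_const.mul ((((contDiff_id (E := Plane)).norm_sq ℝ).neg.div_const _).exp)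

theorem hasFDerivAt_gaussKernel (s : ℝ) (x : Plane) :
    HasFDerivAt (gaussKernel s) ((-(2 * s)⁻¹ * gaussKernel s x) • innerSL ℝ x) x := by
  have h := ((((hasStrictFDerivAt_norm_sq x).hasFDerivAt.neg).mul_const
    (4 * s)⁻¹).exp).const_mul ((4 * Real.pi * s)⁻¹)
  simp only [← div_eq_mul_inv] at h
  refine h.congr_fderiv ?_
  ext v
  simp [gaussKernel]
  ring

theorem fderiv_gaussKernel (s : ℝ) (x v : Plane) :
    fderiv ℝ (gaussKernel s) x v = -(2 * s)⁻¹ * gaussKernel s x * inner ℝ x v := by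
  rw [(hasFDerivAt_gaussKernel s x).fderiv]
  simp

/-- From `u e^{-u} ≤ 1` with `u = ‖x‖²/(4s)`; the bound does not depend on `s`. -/
theorem norm_sq_mul_gaussKernel_le {s : ℝ} (hs : 0 < s) (x : Plane) :
    ‖x‖ ^ 2 * gaussKernel s x ≤ Real.pi⁻¹ := by
  have h := Real.add_one_le_exp (‖x‖ ^ 2 / (4 * s))
  have h1 : Real.exp (-‖x‖ ^ 2 / (4 * s)) * Real.exp (‖x‖ ^ 2 / (4 * s)) = 1 := by
    rw [← Real.exp_add, neg_div, neg_add_cancel, Real.exp_zero]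
  have h2 := Real.exp_pos (-‖x‖ ^ 2 / (4 * s))
  have h3 : Real.exp (-‖x‖ ^ 2 / (4 * s)) * (‖x‖ ^ 2 / (4 * s)) ≤ 1 := by nlinarith
  calc ‖x‖ ^ 2 * gaussKernel s x
      = Real.pi⁻¹ * (Real.exp (-‖x‖ ^ 2 / (4 * s)) * (‖x‖ ^ 2 / (4 * s))) := by
        unfold gaussKernel
        field_simp
    _ ≤ Real.pi⁻¹ * 1 := by gcongr
    _ = _ := mul_one _

theorem norm_mul_gaussKernel_le {s : ℝ} (hs : 0 < s) (x : Plane) :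
    ‖x‖ * gaussKernel s x ≤ (4 * Real.pi * s)⁻¹ + Real.pi⁻¹ := by
  have h1 := norm_sq_mul_gaussKernel_le hs x
  have h2 := gaussKernel_le hs x
  have h3 := gaussKernel_pos hs x
  nlinarith [sq_nonneg (‖x‖ - 1)]

theorem norm_fderiv_gaussKernel_le {s : ℝ} (hs : 0 < s) (x : Plane) :
    ‖fderiv ℝ (gaussKernel s) x‖ ≤ (2 * s)⁻¹ * ((4 * Real.pi * s)⁻¹ + Real.pi⁻¹) := by
  rw [(hasFDerivAt_gaussKernel s x).fderiv, norm_smul, norm_mul, norm_neg, innerSL_apply_norm,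
    Real.norm_of_nonneg (by positivity), Real.norm_of_nonneg (gaussKernel_pos hs x).le, mul_assoc,
    mul_comm (gaussKernel s x)]
  gcongr
  exact norm_mul_gaussKernel_le hs x

theorem heatFlow_apply_mul (s : ℝ) (f : Plane → ℝ) (x : Plane) :
    heatFlow s f x = ∫ y, f y * gaussKernel s (x - y) := by
  rw [heatFlow_apply']
  simp only [smul_eq_mul, mul_comm]

theorem fderiv_heatFlow {f : Plane → ℝ} (hi : Integrable f) {s : ℝ} (hs : 0 < s) (x v : Plane) :
    fderiv ℝ (heatFlow s f) x v = ∫ y, f y * fderiv ℝ (gaussKernel s) (x - y) v := by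
  have h := hasFDerivAt_integral_mul_translate (contDiff_gaussKernel s)
    (fun x => (Real.norm_of_nonneg (gaussKernel_pos hs x).le).trans_le (gaussKernel_le hs x))
    (norm_fderiv_gaussKernel_le hs) hi x
  have h2 : heatFlow s f = fun x => ∫ y, f y * gaussKernel s (x - y) :=
    funext (heatFlow_apply_mul s f)
  rw [h2, h.fderiv, ContinuousLinearMap.integral_apply]
  · simp
  · refine hi.smul_bdd _
      (((contDiff_gaussKernel s).continuous_fderiv one_ne_zero).comp (by fun_prop)).aestronglyMeasurable
      (Eventually.of_forall fun y => norm_fderiv_gaussKernel_le hs (x - y))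

theorem fderiv_fderiv_gaussKernel (s : ℝ) (x v : Plane) :
    fderiv ℝ (fun y => fderiv ℝ (gaussKernel s) y v) x =
      (-(2 * s)⁻¹ * gaussKernel s x) • innerSL ℝ v +
        ((2 * s)⁻¹ ^ 2 * gaussKernel s x * inner ℝ x v) • innerSL ℝ x := by
  have h1 : (fun y => fderiv ℝ (gaussKernel s) y v) =
      fun y => -(2 * s)⁻¹ * gaussKernel s y * innerSL ℝ v y := by
    ext y
    rw [fderiv_gaussKernel, innerSL_apply_apply, real_inner_comm]
  have h2 : HasFDerivAt (fun y => -(2 * s)⁻¹ * gaussKernel s y * innerSL ℝ v y) _ x :=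
    ((hasFDerivAt_gaussKernel s x).const_mul (-(2 * s)⁻¹)).mul (innerSL ℝ v).hasFDerivAt
  rw [h1, h2.fderiv]
  ext w
  simp [real_inner_comm]
  ring

theorem contDiff_fderiv_gaussKernel (s : ℝ) (v : Plane) :
    ContDiff ℝ 1 (fun y => fderiv ℝ (gaussKernel s) y v) :=
  (((contDiff_gaussKernel s (n := 2)).fderiv_right (m := 1) (by norm_num)).clm_apply
    contDiff_const)

theorem norm_fderiv_fderiv_gaussKernel_le {s : ℝ} (hs : 0 < s) (v x : Plane) :
    ‖fderiv ℝ (fun y => fderiv ℝ (gaussKernel s) y v) x‖ ≤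
      (2 * s)⁻¹ * (4 * Real.pi * s)⁻¹ * ‖v‖ + (2 * s)⁻¹ ^ 2 * Real.pi⁻¹ * ‖v‖ := by
  rw [fderiv_fderiv_gaussKernel]
  have hp := gaussKernel_pos hs x
  refine (norm_add_le _ _).trans (add_le_add ?_ ?_)
  · rw [norm_smul, innerSL_apply_norm, norm_mul, norm_neg, Real.norm_of_nonneg (by positivity),
      Real.norm_of_nonneg hp.le]
    gcongr
    exact gaussKernel_le hs x
  · rw [norm_smul, innerSL_apply_norm, norm_mul, Real.norm_of_nonneg (by positivity)]
    calc (2 * s)⁻¹ ^ 2 * gaussKernel s x * ‖inner ℝ x v‖ * ‖x‖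
        ≤ (2 * s)⁻¹ ^ 2 * gaussKernel s x * (‖x‖ * ‖v‖) * ‖x‖ := by
          gcongr
          exact norm_inner_le_norm x v
      _ = (2 * s)⁻¹ ^ 2 * (‖x‖ ^ 2 * gaussKernel s x) * ‖v‖ := by ring
      _ ≤ _ := by
          gcongr
          exact norm_sq_mul_gaussKernel_le hs x

theorem fderiv_fderiv_heatFlow {f : Plane → ℝ} (hi : Integrable f) {s : ℝ} (hs : 0 < s)
    (x v : Plane) :
    fderiv ℝ (fun y => fderiv ℝ (heatFlow s f) y v) x v =
      ∫ y, f y * fderiv ℝ (fun y => fderiv ℝ (gaussKernel s) y v) (x - y) v := by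
  have hsm := contDiff_fderiv_gaussKernel s v
  have hb : ∀ x, ‖fderiv ℝ (gaussKernel s) x v‖ ≤
      (2 * s)⁻¹ * ((4 * Real.pi * s)⁻¹ + Real.pi⁻¹) * ‖v‖ := fun x =>
    (ContinuousLinearMap.le_opNorm _ _).trans (by gcongr; exact norm_fderiv_gaussKernel_le hs x)
  have h := hasFDerivAt_integral_mul_translate hsm hb (norm_fderiv_fderiv_gaussKernel_le hs v) hi x
  have h2 : (fun y => fderiv ℝ (heatFlow s f) y v) =
      fun x => ∫ y, f y * fderiv ℝ (gaussKernel s) (x - y) v :=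
    funext fun y => fderiv_heatFlow hi hs y v
  rw [h2, h.fderiv, ContinuousLinearMap.integral_apply]
  · simp
  · refine hi.smul_bdd _ ((hsm.continuous_fderiv one_ne_zero).comp
      (by fun_prop)).aestronglyMeasurable (Eventually.of_forall fun y =>
        norm_fderiv_fderiv_gaussKernel_le hs v (x - y))

theorem laplacian_eq_sum_fderiv {f : Plane → ℝ} (hf : ContDiff ℝ 2 f) (x : Plane) :
    (Δ f) x = ∑ i : Fin 2, fderiv ℝ (fun y => fderiv ℝ f y (EuclideanSpace.single i 1)) x
      (EuclideanSpace.single i 1) := by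
  rw [InnerProductSpace.laplacian_eq_iteratedFDeriv_orthonormalBasis f
    (EuclideanSpace.basisFun (Fin 2) ℝ)]
  refine Finset.sum_congr rfl fun i _ => ?_
  rw [iteratedFDeriv_two_apply]
  have h : DifferentiableAt ℝ (fderiv ℝ f) x :=
    (hf.fderiv_right (m := 1) (by norm_num)).differentiable one_ne_zero x
  rw [fderiv_clm_apply h (differentiableAt_const _)]
  simp

theorem hasDerivAt_gaussKernel {s : ℝ} (hs : 0 < s) (x : Plane) :
    HasDerivAt (fun s => gaussKernel s x)
      (gaussKernel s x * (‖x‖ ^ 2 / (4 * s ^ 2) - s⁻¹)) s := by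
  have h1 : HasDerivAt (fun s : ℝ => (4 * Real.pi * s)⁻¹)
      (-(4 * Real.pi * 1) / (4 * Real.pi * s) ^ 2) s :=
    ((hasDerivAt_id s).const_mul (4 * Real.pi)).inv (by simp [hs.ne', Real.pi_ne_zero])
  have h2 : HasDerivAt (fun s : ℝ => -‖x‖ ^ 2 / (4 * s))
      ((0 * (4 * s) - -‖x‖ ^ 2 * (4 * 1)) / (4 * s) ^ 2) s :=
    (hasDerivAt_const s (-‖x‖ ^ 2)).div ((hasDerivAt_id s).const_mul 4) (by simp [hs.ne'])
  refine (h1.mul h2.exp).congr_deriv ?_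
  unfold gaussKernel
  have := Real.pi_pos
  field_simp
  ring

/-- Differentiation under the integral, on times `r > s/2` so that the kernel bounds are uniform in
`r`. -/
theorem deriv_heatFlow {f : Plane → ℝ} (hi : Integrable f) {s : ℝ} (hs : 0 < s) (x : Plane) :
    HasDerivAt (fun s => heatFlow s f x) (∫ y, f y * (gaussKernel s (x - y) *
      (‖x - y‖ ^ 2 / (4 * s ^ 2) - s⁻¹))) s := by
  simp only [heatFlow_apply_mul]
  refine (hasDerivAt_integral_of_dominated_loc_of_deriv_le (𝕜 := ℝ) (s := Ioi (s / 2))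
    (F := fun s y => f y * gaussKernel s (x - y)) (F' := fun s y => f y * (gaussKernel s (x - y) *
      (‖x - y‖ ^ 2 / (4 * s ^ 2) - s⁻¹)))
    (bound := fun y => ‖f y‖ * (Real.pi⁻¹ * (4 * (s / 2) ^ 2)⁻¹ +
      (4 * Real.pi * (s / 2))⁻¹ * (s / 2)⁻¹))
    (Ioi_mem_nhds (half_lt_self hs)) (Eventually.of_forall fun r => ?_) ?_ ?_
    (Eventually.of_forall fun y r hr => ?_) (hi.norm.mul_const _)
    (Eventually.of_forall fun y r hr => ?_)).2
  · exact hi.1.mul ((continuous_gaussKernel r).comp (by fun_prop)).aestronglyMeasurable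
  · exact hi.mul_bdd ((continuous_gaussKernel s).comp (by fun_prop)).aestronglyMeasurable
      (Eventually.of_forall fun y => (Real.norm_of_nonneg (gaussKernel_pos hs _).le).trans_le
        (gaussKernel_le hs _))
  · refine hi.1.mul (Continuous.aestronglyMeasurable ?_)
    exact ((continuous_gaussKernel s).comp (by fun_prop)).mul (by fun_prop)
  · have hr : s / 2 < r := hr
    have hr0 : 0 < r := by linarith
    have hp := gaussKernel_pos hr0 (x - y)
    rw [norm_mul, mul_sub]
    gcongr
    refine (norm_sub_le _ _).trans (add_le_add ?_ ?_)
    · rw [Real.norm_of_nonneg (by positivity), div_eq_mul_inv, ← mul_assoc,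
        mul_comm (gaussKernel r _)]
      gcongr
      exact norm_sq_mul_gaussKernel_le hr0 _
    · rw [Real.norm_of_nonneg (by positivity)]
      gcongr
      exact (gaussKernel_le hr0 _).trans (by gcongr)
  · have hr : s / 2 < r := hr
    exact (hasDerivAt_gaussKernel (by linarith) _).const_mul _

theorem deriv_heatFlow_eq_laplacian {f : Plane → ℝ} (hi : Integrable f) (hf : HasCompactSupport f)
    {s : ℝ} (hs : 0 < s) (x : Plane) :
    HasDerivAt (fun s => heatFlow s f x) ((Δ (heatFlow s f)) x) s := by
  refine (deriv_heatFlow hi hs x).congr_deriv ?_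
  rw [laplacian_eq_sum_fderiv (contDiff_infty.1 (contDiff_heatFlow hi hf hs) 2)]
  simp only [fderiv_fderiv_heatFlow hi hs]
  rw [← integral_finsetSum]
  · refine integral_congr_ae (Eventually.of_forall fun y => ?_)
    simp only [Fin.sum_univ_two, fderiv_fderiv_gaussKernel, norm_sq_eq_sum]
    simp [EuclideanSpace.inner_single_right]
    field_simp
    ring
  · intro i _
    refine hi.mul_bdd (Continuous.aestronglyMeasurable ?_)
      (Eventually.of_forall fun y => (ContinuousLinearMap.le_opNorm _ _).trans
        (mul_le_mul_of_nonneg_right (norm_fderiv_fderiv_gaussKernel_le hs _ _) (norm_nonneg _)))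
    exact (((contDiff_fderiv_gaussKernel s _).continuous_fderiv one_ne_zero).comp
      (by fun_prop)).clm_apply continuous_const

/-! ### The heat flow of `1 / |x|` -/

/-- Subordination: the substitution `α = 1/u` on the half-line turns this into a Gaussian integral.
It presents `1/|y|` as a superposition of heat kernels, on which the heat flow acts by shifting
time. -/
theorem integral_gaussKernel_sq {y : Plane} (hy : y ≠ 0) :
    ∫ α : ℝ, gaussKernel (α ^ 2) y = (2 * √Real.pi)⁻¹ * ‖y‖⁻¹ := by
  have hn : 0 < ‖y‖ := norm_pos_iff.2 hy
  have h1 : ∀ α : ℝ, gaussKernel (α ^ 2) y = (fun r : ℝ => gaussKernel (r ^ 2) y) |α| := fun α => by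
    simp
  rw [integral_congr_ae (Eventually.of_forall h1),
    integral_comp_abs (f := fun r : ℝ => gaussKernel (r ^ 2) y)]
  have h2 := integral_comp_rpow_Ioi
    (fun u : ℝ => (4 * Real.pi)⁻¹ * Real.exp (-(‖y‖ ^ 2 / 4) * u ^ 2)) (p := -1) (by norm_num)
  rw [integral_const_mul, integral_gaussian_Ioi] at h2
  have h3 : ∫ r in Ioi (0 : ℝ), gaussKernel (r ^ 2) y =
      (4 * Real.pi)⁻¹ * (√(Real.pi / (‖y‖ ^ 2 / 4)) / 2) := by
    rw [← h2]
    refine setIntegral_congr_fun measurableSet_Ioi fun r hr => ?_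
    have hr0 : (0 : ℝ) < r := hr
    rw [Real.rpow_neg_one, show (-1 : ℝ) - 1 = -(2 : ℕ) by norm_num, Real.rpow_neg hr0.le,
      Real.rpow_natCast, gaussKernel]
    simp only [abs_neg, abs_one, one_mul, smul_eq_mul]
    rw [mul_inv (4 * Real.pi), show -‖y‖ ^ 2 / (4 * r ^ 2) = -(‖y‖ ^ 2 / 4) * r⁻¹ ^ 2 by
      field_simp]
    ring
  rw [h3, show Real.pi / (‖y‖ ^ 2 / 4) = (2 / ‖y‖) ^ 2 * Real.pi by field_simp; norm_num,
    Real.sqrt_mul (by positivity), Real.sqrt_sq (by positivity)]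
  have h4 : Real.pi = √Real.pi ^ 2 := (Real.sq_sqrt Real.pi_pos.le).symm
  have h5 : 0 < √Real.pi := Real.sqrt_pos.2 Real.pi_pos
  field_simp
  linear_combination -4 * h4

/-! ### Semigroup law and the explicit heat flow of `1 / |x|` -/

theorem gaussKernel_mul_gaussKernel {s r : ℝ} (hs : 0 < s) (hr : 0 < r) (x y : Plane) :
    gaussKernel s (x - y) * gaussKernel r y =
      gaussKernel (s + r) x * gaussKernel (s * r / (s + r)) (y - (r / (s + r)) • x) := by
  have hsr : 0 < s + r := by positivity
  have hpi := Real.pi_pos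
  unfold gaussKernel
  rw [mul_mul_mul_comm, mul_mul_mul_comm (4 * Real.pi * (s + r))⁻¹, ← Real.exp_add, ← Real.exp_add]
  congr 1
  · field_simp
  · congr 1
    simp only [norm_sq_eq_sum, PiLp.sub_apply, PiLp.smul_apply, smul_eq_mul]
    field_simp
    ring

theorem integrable_gaussKernel_mul_gaussKernel {s r : ℝ} (hs : 0 < s) (hr : 0 < r) (x : Plane) :
    Integrable fun y => gaussKernel s (x - y) * gaussKernel r y := by
  simp only [gaussKernel_mul_gaussKernel hs hr]
  exact ((integrable_gaussKernel (by positivity)).comp_sub_right _).const_mul _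

theorem integral_gaussKernel_mul_gaussKernel {s r : ℝ} (hs : 0 < s) (hr : 0 < r) (x : Plane) :
    ∫ y, gaussKernel s (x - y) * gaussKernel r y = gaussKernel (s + r) x := by
  simp only [gaussKernel_mul_gaussKernel hs hr]
  rw [integral_const_mul, integral_sub_right_eq_self (gaussKernel _),
    integral_gaussKernel (by positivity), mul_one]

theorem measurable_gaussKernel_sq_add (s : ℝ) :
    Measurable fun q : ℝ × Plane => gaussKernel (q.1 ^ 2 + s) q.2 := by
  unfold gaussKernel
  fun_prop

theorem inv_sq_add_le {s : ℝ} (hs : 0 < s) (α : ℝ) :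
    (α ^ 2 + s)⁻¹ ≤ (1 + s⁻¹) * (1 + α ^ 2)⁻¹ := by
  rw [← div_eq_mul_inv, inv_eq_one_div, div_le_div_iff₀ (by positivity) (by positivity)]
  have h : s⁻¹ * s = 1 := inv_mul_cancel₀ hs.ne'
  have h2 : 0 ≤ s⁻¹ * α ^ 2 := by positivity
  nlinarith

theorem integrable_inv_sq_add {s : ℝ} (hs : 0 < s) : Integrable fun α : ℝ => (α ^ 2 + s)⁻¹ := by
  refine (integrable_inv_one_add_sq.const_mul (1 + s⁻¹)).mono'
    (by fun_prop) (Eventually.of_forall fun α => ?_)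
  rw [Real.norm_of_nonneg (by positivity)]
  exact inv_sq_add_le hs α

theorem integrable_gaussKernel_sq_add {s : ℝ} (hs : 0 < s) (x : Plane) :
    Integrable fun α : ℝ => gaussKernel (α ^ 2 + s) x := by
  refine ((integrable_inv_sq_add hs).const_mul (4 * Real.pi)⁻¹).mono'
    ((measurable_gaussKernel_sq_add s).comp (by fun_prop : Measurable fun α : ℝ =>
      (α, x))).aestronglyMeasurable (Eventually.of_forall fun α => ?_)
  have h : 0 < α ^ 2 + s := by positivity
  rw [Real.norm_of_nonneg (gaussKernel_pos h x).le, ← mul_inv]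
  exact gaussKernel_le h x

theorem ae_ne_zero_real : ∀ᵐ α : ℝ, α ≠ 0 := by
  simp [ae_iff, measure_singleton]

theorem ae_ne_zero_plane : ∀ᵐ y : Plane, y ≠ 0 := by
  simp [ae_iff, measure_singleton]

/-- The integrand is positive, so it suffices to integrate in `y` first: the semigroup law leaves
`gaussKernel (α² + s) x`, which is `O((α² + s)⁻¹)`. -/
theorem heatFlow_inv_norm_aux {s : ℝ} (hs : 0 < s) (x : Plane) :
    Integrable (fun q : Plane × ℝ => gaussKernel s (x - q.1) * gaussKernel (q.2 ^ 2) q.1)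
      (volume.prod volume) := by
  rw [integrable_prod_iff']
  · constructor
    · filter_upwards [ae_ne_zero_real] with α hα
      exact integrable_gaussKernel_mul_gaussKernel hs (by positivity) x
    · refine (integrable_gaussKernel_sq_add hs x).congr ?_
      filter_upwards [ae_ne_zero_real] with α hα
      have hα2 : 0 < α ^ 2 := by positivity
      rw [add_comm, ← integral_gaussKernel_mul_gaussKernel hs hα2]
      refine integral_congr_ae (Eventually.of_forall fun y => ?_)
      exact (Real.norm_of_nonneg
        (mul_pos (gaussKernel_pos hs _) (gaussKernel_pos hα2 _)).le).symm
  · refine Measurable.aestronglyMeasurable ?_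
    unfold gaussKernel
    fun_prop

theorem integrable_gaussKernel_mul_inv_norm {s : ℝ} (hs : 0 < s) (x : Plane) :
    Integrable fun y => gaussKernel s (x - y) * ‖y‖⁻¹ := by
  refine ((heatFlow_inv_norm_aux hs x).integral_prod_left.const_mul (2 * √Real.pi)).congr ?_
  filter_upwards [ae_ne_zero_plane] with y hy
  simp only [integral_const_mul]
  rw [integral_gaussKernel_sq hy]
  have h5 : 0 < √Real.pi := Real.sqrt_pos.2 Real.pi_pos
  field_simp

theorem integral_gaussKernel_mul_inv_norm {s : ℝ} (hs : 0 < s) (x : Plane) :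
    ∫ y, gaussKernel s (x - y) * ‖y‖⁻¹ =
      2 * √Real.pi * ∫ α : ℝ, gaussKernel (α ^ 2 + s) x := by
  have h5 : 0 < √Real.pi := Real.sqrt_pos.2 Real.pi_pos
  have h := integral_integral_swap (f := fun y (α : ℝ) =>
    gaussKernel s (x - y) * gaussKernel (α ^ 2) y) (heatFlow_inv_norm_aux hs x)
  have h1 : ∫ y, gaussKernel s (x - y) * ‖y‖⁻¹ =
      2 * √Real.pi * ∫ y, ∫ α : ℝ, gaussKernel s (x - y) * gaussKernel (α ^ 2) y := by
    rw [← integral_const_mul]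
    refine integral_congr_ae ?_
    filter_upwards [ae_ne_zero_plane] with y hy
    rw [integral_const_mul, integral_gaussKernel_sq hy]
    field_simp
  rw [h1, h]
  congr 1
  refine integral_congr_ae ?_
  filter_upwards [ae_ne_zero_real] with α hα
  rw [integral_gaussKernel_mul_gaussKernel hs (by positivity), add_comm]

/-- The gradient of the heat flow of `1 / |x|` is `-2√π gradProfile s x • x`. -/
def gradProfile (s : ℝ) (x : Plane) : ℝ :=
  ∫ α : ℝ, (2 * (α ^ 2 + s))⁻¹ * gaussKernel (α ^ 2 + s) x

theorem hasFDerivAt_integral_gaussKernel {s : ℝ} (hs : 0 < s) (x : Plane) :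
    HasFDerivAt (fun x => ∫ α : ℝ, gaussKernel (α ^ 2 + s) x)
      (-gradProfile s x • innerSL ℝ x) x := by
  have h0 : ∀ α : ℝ, 0 < α ^ 2 + s := fun α => by positivity
  have hm : ∀ x, AEStronglyMeasurable (fun α : ℝ => gaussKernel (α ^ 2 + s) x) volume := fun x =>
    (integrable_gaussKernel_sq_add hs x).1
  have h := hasFDerivAt_integral_of_dominated_of_fderiv_le (𝕜 := ℝ) (s := univ) (x₀ := x)
    (μ := volume) (F := fun x (α : ℝ) => gaussKernel (α ^ 2 + s) x)
    (F' := fun x (α : ℝ) => (-(2 * (α ^ 2 + s))⁻¹ * gaussKernel (α ^ 2 + s) x) • innerSL ℝ x)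
    (bound := fun α : ℝ => (2 : ℝ)⁻¹ * ((4 * Real.pi * s)⁻¹ + Real.pi⁻¹) * (α ^ 2 + s)⁻¹)
    univ_mem (Eventually.of_forall fun x => hm x) (integrable_gaussKernel_sq_add hs x) ?_
    (Eventually.of_forall fun α y _ => ?_) ((integrable_inv_sq_add hs).const_mul _)
    (Eventually.of_forall fun α y _ => hasFDerivAt_gaussKernel _ y)
  · refine h.congr_fderiv ?_
    rw [integral_smul_const, gradProfile, ← integral_neg]
    simp only [neg_mul]
  · exact (AEStronglyMeasurable.mul (by fun_prop) (hm x)).smul_const _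
  · rw [norm_smul, norm_mul, norm_neg, innerSL_apply_norm, Real.norm_of_nonneg (by positivity),
      Real.norm_of_nonneg (gaussKernel_pos (h0 α) y).le, mul_inv]
    calc 2⁻¹ * (α ^ 2 + s)⁻¹ * gaussKernel (α ^ 2 + s) y * ‖y‖
        = 2⁻¹ * (‖y‖ * gaussKernel (α ^ 2 + s) y) * (α ^ 2 + s)⁻¹ := by ring
      _ ≤ 2⁻¹ * ((4 * Real.pi * (α ^ 2 + s))⁻¹ + Real.pi⁻¹) * (α ^ 2 + s)⁻¹ := by
        gcongr
        exact norm_mul_gaussKernel_le (h0 α) y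
      _ ≤ _ := by
        gcongr
        nlinarith [sq_nonneg α]

/-- Substitute `α = √s β`. This is the homogeneity that makes the dissipation density self-similar.
-/
theorem gradProfile_scale {s : ℝ} (hs : 0 < s) (z : Plane) :
    gradProfile s (√s • z) = s⁻¹ ^ 2 * √s * gradProfile 1 z := by
  have hc : 0 < √s := Real.sqrt_pos.2 hs
  have h2 : √s ^ 2 = s := Real.sq_sqrt hs.le
  have h := Measure.integral_comp_mul_left
    (fun α : ℝ => (2 * (α ^ 2 + s))⁻¹ * gaussKernel (α ^ 2 + s) (√s • z)) (√s)
  have h1 : ∀ β : ℝ, (2 * ((√s * β) ^ 2 + s))⁻¹ * gaussKernel ((√s * β) ^ 2 + s) (√s • z) =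
      s⁻¹ ^ 2 * ((2 * (β ^ 2 + 1))⁻¹ * gaussKernel (β ^ 2 + 1) z) := fun β => by
    have : (√s * β) ^ 2 + s = √s ^ 2 * (β ^ 2 + 1) := by rw [mul_pow, h2]; ring
    rw [this, gaussKernel_scale hc, h2, show 2 * (s * (β ^ 2 + 1)) = s * (2 * (β ^ 2 + 1)) by ring,
      mul_inv]
    ring
  simp only [h1] at h
  rw [integral_const_mul, abs_of_pos (by positivity), smul_eq_mul] at h
  rw [gradProfile, gradProfile]
  have h3 : ∀ a b : ℝ, a = (√s)⁻¹ * b → b = √s * a := fun a b hab => by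
    rw [hab]; field_simp
  rw [h3 _ _ h]
  ring

/-! ### Total mass of the limiting dissipation profile -/

theorem integral_norm_sq_mul_exp {c : ℝ} (hc : 0 < c) :
    ∫ z : Plane, ‖z‖ ^ 2 * Real.exp (-c * ‖z‖ ^ 2) = Real.pi / c ^ 2 := by
  rw [integral_fun_norm_addHaar (volume : Measure Plane)
    (fun y : ℝ => y ^ 2 * Real.exp (-c * y ^ 2))]
  have hv : (volume : Measure Plane).real (ball 0 1) = Real.pi := by
    simp [Measure.real, EuclideanSpace.volume_ball_fin_two, Real.pi_pos.le]
  have h := integral_rpow_mul_exp_neg_mul_rpow (p := 2) (q := 3) (b := c) (by norm_num)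
    (by norm_num) hc
  have h2 : ∫ y in Ioi (0 : ℝ), y ^ (Module.finrank ℝ Plane - 1) • (y ^ 2 * Real.exp (-c * y ^ 2)) =
      c⁻¹ ^ 2 * (1 / 2) := by
    rw [finrank_euclideanSpace_fin]
    have h3 : ((3 : ℝ) + 1) / 2 = 1 + 1 := by norm_num
    have h4 : -((3 : ℝ) + 1) / 2 = -(2 : ℕ) := by norm_num
    rw [h4, h3, Real.Gamma_add_one one_ne_zero, Real.Gamma_one, Real.rpow_neg hc.le,
      Real.rpow_natCast] at h
    rw [inv_pow]
    simp only [mul_one] at h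
    rw [← h]
    refine setIntegral_congr_fun measurableSet_Ioi fun y hy => ?_
    simp only [smul_eq_mul]
    rw [show (3 : ℝ) = (3 : ℕ) by norm_num, Real.rpow_natCast, Real.rpow_two]
    ring_nf
  rw [h2, hv, finrank_euclideanSpace_fin, nsmul_eq_mul, smul_eq_mul]
  push_cast
  field_simp

/-- The product of the two Gaussians is a Gaussian with rate `(a + b)/(4ab)`. The factor `4π` is the
square of the subordination constant `2√π`. -/
theorem integral_norm_sq_mul_gaussKernel_mul {a b : ℝ} (ha : 0 < a) (hb : 0 < b) :
    ∫ z, 4 * Real.pi * ‖z‖ ^ 2 * (((2 * a)⁻¹ * gaussKernel a z) * ((2 * b)⁻¹ * gaussKernel b z)) =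
      ((a + b) ^ 2)⁻¹ := by
  have hpi := Real.pi_pos
  have h : ∀ z : Plane, 4 * Real.pi * ‖z‖ ^ 2 *
      (((2 * a)⁻¹ * gaussKernel a z) * ((2 * b)⁻¹ * gaussKernel b z)) =
      (16 * Real.pi * a ^ 2 * b ^ 2)⁻¹ * (‖z‖ ^ 2 * Real.exp (-((a + b) / (4 * a * b)) * ‖z‖ ^ 2)) := by
    intro z
    have : Real.exp (-((a + b) / (4 * a * b)) * ‖z‖ ^ 2) =
        Real.exp (-‖z‖ ^ 2 / (4 * a)) * Real.exp (-‖z‖ ^ 2 / (4 * b)) := by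
      rw [← Real.exp_add]
      congr 1
      field_simp
      ring
    rw [this]
    unfold gaussKernel
    field_simp
    ring
  simp only [h]
  rw [integral_const_mul, integral_norm_sq_mul_exp (by positivity)]
  field_simp
  norm_num

theorem integral_Ioi_mul_inv_sq : ∫ ρ in Ioi (0 : ℝ), ρ * ((2 + ρ ^ 2) ^ 2)⁻¹ = 1 / 4 := by
  have hd : ∀ ρ ∈ Ici (0 : ℝ), HasDerivAt (fun ρ : ℝ => -(2 : ℝ)⁻¹ * (2 + ρ ^ 2)⁻¹)
      (ρ * ((2 + ρ ^ 2) ^ 2)⁻¹) ρ := fun ρ _ => by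
    have h0 : 2 + ρ ^ 2 ≠ 0 := by positivity
    refine (((hasDerivAt_pow 2 ρ).const_add 2).fun_inv h0).const_mul (-(2 : ℝ)⁻¹) |>.congr_deriv ?_
    field_simp
    norm_num
  have hl : Tendsto (fun ρ : ℝ => -(2 : ℝ)⁻¹ * (2 + ρ ^ 2)⁻¹) atTop (𝓝 (-(2 : ℝ)⁻¹ * 0)) :=
    ((tendsto_atTop_add_const_left _ _ (tendsto_pow_atTop two_ne_zero)).inv_tendsto_atTop).const_mul _
  rw [integral_Ioi_of_hasDerivAt_of_nonneg' hd (fun ρ hρ => by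
    have : (0 : ℝ) < ρ := hρ
    positivity) hl]
  norm_num

theorem integral_inv_sq_plane :
    ∫ q : ℝ × ℝ, ((q.1 ^ 2 + 1 + (q.2 ^ 2 + 1)) ^ 2)⁻¹ = Real.pi / 2 := by
  rw [← integral_comp_polarCoord_symm]
  have h : ∀ p : ℝ × ℝ, p.1 • (((polarCoord.symm p).1 ^ 2 + 1 + ((polarCoord.symm p).2 ^ 2 + 1)) ^ 2)⁻¹
      = (p.1 * ((2 + p.1 ^ 2) ^ 2)⁻¹) * (fun _ : ℝ => (1 : ℝ)) p.2 := fun p => by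
    rw [polarCoord_symm_apply, smul_eq_mul, mul_one]
    congr 3
    linear_combination p.1 ^ 2 * Real.sin_sq_add_cos_sq p.2
  simp only [h]
  rw [polarCoord_target, Measure.volume_eq_prod]
  refine (setIntegral_prod_mul (fun ρ : ℝ => ρ * ((2 + ρ ^ 2) ^ 2)⁻¹) (fun _ => (1 : ℝ))
    (Ioi 0) (Ioo (-Real.pi) Real.pi)).trans ?_
  rw [integral_Ioi_mul_inv_sq]
  simp [Real.pi_pos.le]
  ring

/-- The limit profile of the enstrophy dissipation. -/
def enstrophyProfile (z : Plane) : ℝ := 4 * Real.pi * ‖z‖ ^ 2 * gradProfile 1 z ^ 2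

/-- Justifies Fubini for the squared profile, expanded as a double integral over `(α, β)`: the
integrand is nonnegative, and integrating in `z` first leaves `(α² + β² + 2)⁻²`. -/
theorem enstrophyProfile_aux :
    Integrable (fun q : Plane × (ℝ × ℝ) => 4 * Real.pi * ‖q.1‖ ^ 2 *
      (((2 * (q.2.1 ^ 2 + 1))⁻¹ * gaussKernel (q.2.1 ^ 2 + 1) q.1) *
        ((2 * (q.2.2 ^ 2 + 1))⁻¹ * gaussKernel (q.2.2 ^ 2 + 1) q.1)))
      (volume.prod volume) := by
  have h1 : ∀ α : ℝ, 0 < α ^ 2 + 1 := fun α => by positivity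
  have hpi := Real.pi_pos
  rw [integrable_prod_iff']
  · constructor
    · refine Eventually.of_forall fun q => .of_integral_ne_zero ?_
      dsimp only
      rw [integral_norm_sq_mul_gaussKernel_mul (h1 _) (h1 _)]
      have := h1 q.1
      have := h1 q.2
      positivity
    · have : Integrable fun q : ℝ × ℝ => ((q.1 ^ 2 + 1 + (q.2 ^ 2 + 1)) ^ 2)⁻¹ :=
        .of_integral_ne_zero (by rw [integral_inv_sq_plane]; positivity)
      refine this.congr (Eventually.of_forall fun q => ?_)
      simp only
      rw [← integral_norm_sq_mul_gaussKernel_mul (h1 _) (h1 _)]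
      refine integral_congr_ae (Eventually.of_forall fun z => ?_)
      have := gaussKernel_pos (h1 q.1) z
      have := gaussKernel_pos (h1 q.2) z
      exact (Real.norm_of_nonneg (by positivity)).symm
  · refine Measurable.aestronglyMeasurable ?_
    unfold gaussKernel
    fun_prop

theorem enstrophyProfile_eq (z : Plane) : enstrophyProfile z =
    ∫ q : ℝ × ℝ, 4 * Real.pi * ‖z‖ ^ 2 *
      (((2 * (q.1 ^ 2 + 1))⁻¹ * gaussKernel (q.1 ^ 2 + 1) z) *
        ((2 * (q.2 ^ 2 + 1))⁻¹ * gaussKernel (q.2 ^ 2 + 1) z)) := by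
  rw [integral_const_mul, Measure.volume_eq_prod,
    integral_prod_mul (fun α : ℝ => (2 * (α ^ 2 + 1))⁻¹ * gaussKernel (α ^ 2 + 1) z)
    (fun α : ℝ => (2 * (α ^ 2 + 1))⁻¹ * gaussKernel (α ^ 2 + 1) z), ← pow_two]
  rfl

theorem integrable_enstrophyProfile : Integrable enstrophyProfile := by
  refine enstrophyProfile_aux.integral_prod_left.congr (Eventually.of_forall fun z => ?_)
  exact (enstrophyProfile_eq z).symm

theorem integral_enstrophyProfile : ∫ z, enstrophyProfile z = Real.pi / 2 := by
  have h1 : ∀ α : ℝ, 0 < α ^ 2 + 1 := fun α => by positivity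
  simp only [enstrophyProfile_eq]
  rw [integral_integral_swap enstrophyProfile_aux, ← integral_inv_sq_plane]
  refine integral_congr_ae (Eventually.of_forall fun q => ?_)
  exact integral_norm_sq_mul_gaussKernel_mul (h1 _) (h1 _)

/-! ### The singular vorticity and its heat flow -/

/-- A smooth radial cutoff function, supported in the unit ball and equal to `1` on the ball of
radius `1 / 2`. -/
structure IsRadialCutoff (φ : Plane → ℝ) : Prop where
  smooth : ContDiff ℝ (⊤ : ℕ∞) φ
  radial : IsRadial φ
  supp : tsupport φ ⊆ ball 0 1
  one : ∀ x ∈ ball (0 : Plane) (1 / 2), φ x = 1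

namespace IsRadialCutoff

variable {φ : Plane → ℝ}

theorem eq_zero (hφ : IsRadialCutoff φ) {x : Plane} (hx : 1 ≤ ‖x‖) : φ x = 0 :=
  image_eq_zero_of_notMem_tsupport fun h => by
    have := hφ.supp h
    rw [mem_ball_zero_iff] at this
    linarith

theorem hasCompactSupport (hφ : IsRadialCutoff φ) : HasCompactSupport φ :=
  .of_support_subset_isCompact (isCompact_closedBall (0 : Plane) 1)
    ((subset_tsupport φ).trans (hφ.supp.trans ball_subset_closedBall))

theorem singularVorticity_eq_zero (hφ : IsRadialCutoff φ) {x : Plane} (hx : 1 ≤ ‖x‖) :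
    singularVorticity φ x = 0 := by
  rw [singularVorticity, hφ.eq_zero hx, zero_div]

theorem hasCompactSupport_singularVorticity (hφ : IsRadialCutoff φ) :
    HasCompactSupport (singularVorticity φ) :=
  .of_support_subset_isCompact (isCompact_closedBall (0 : Plane) 1) fun x hx => by
    rw [mem_closedBall_zero_iff]
    by_contra h
    exact hx (hφ.singularVorticity_eq_zero (not_le.1 h).le)

theorem isRadial_singularVorticity (hφ : IsRadialCutoff φ) : IsRadial (singularVorticity φ) :=
  fun x y h => by rw [singularVorticity, singularVorticity, hφ.radial x y h, h]

theorem measurable_singularVorticity (hφ : IsRadialCutoff φ) : Measurable (singularVorticity φ) :=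
  hφ.smooth.continuous.measurable.div measurable_norm

theorem exists_bound (hφ : IsRadialCutoff φ) : ∃ B : ℝ, 0 ≤ B ∧ (∀ x, ‖φ x‖ ≤ B) ∧
    ∀ x, ‖singularVorticity φ x‖ ≤ B * ‖x‖⁻¹ := by
  obtain ⟨B, hB⟩ := hφ.hasCompactSupport.exists_bound_of_continuous hφ.smooth.continuous
  refine ⟨B, (norm_nonneg _).trans (hB 0), hB, fun x => ?_⟩
  rw [singularVorticity, norm_div, norm_norm, div_eq_mul_inv]
  gcongr
  exact hB x

theorem memLp_singularVorticity (hφ : IsRadialCutoff φ) {p : ℝ≥0∞} (hp : 1 ≤ p) (hp2 : p < 2) :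
    MemLp (singularVorticity φ) p volume := by
  obtain ⟨B, hB0, -, hB⟩ := hφ.exists_bound
  have hp0 : p ≠ 0 := (one_pos.trans_le hp).ne'
  have hpt : p ≠ ∞ := (hp2.trans (by simp)).ne
  have hm := hφ.measurable_singularVorticity
  rw [← integrable_norm_rpow_iff hm.aestronglyMeasurable hp0 hpt,
    ← integrableOn_iff_integrable_of_support_subset (s := ball 0 1)]
  · refine integrableOn_ball_of_norm_le_rpow (C := B ^ p.toReal) (α := p.toReal) (by simp) ?_
      (Eventually.of_forall fun x => ?_) (hm.norm.pow_const _).aestronglyMeasurable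
    · rw [finrank_euclideanSpace_fin]
      exact (ENNReal.toReal_lt_toReal hpt (by simp)).2 hp2
    · rw [Real.norm_of_nonneg (by positivity), Real.rpow_neg (norm_nonneg _),
        ← Real.inv_rpow (norm_nonneg _), ← Real.mul_rpow hB0 (by positivity)]
      exact Real.rpow_le_rpow (norm_nonneg _) (hB x) ENNReal.toReal_nonneg
  · intro x hx
    rw [mem_ball_zero_iff]
    by_contra h
    refine hx ?_
    simp only
    rw [hφ.singularVorticity_eq_zero (not_lt.1 h), norm_zero,
      Real.zero_rpow (ENNReal.toReal_pos hp0 hpt).ne']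

theorem integrable_singularVorticity (hφ : IsRadialCutoff φ) :
    Integrable (singularVorticity φ) :=
  memLp_one_iff_integrable.1 (hφ.memLp_singularVorticity le_rfl (by simp))

/-- The smooth part `(1 - φ) / |x|` of the singular vorticity. -/
def _root_.EnstrophyDefect.smoothPart (φ : Plane → ℝ) (x : Plane) : ℝ := (1 - φ x) / ‖x‖

/-- Near the origin `φ = 1` and the function vanishes; elsewhere the norm is smooth. -/
theorem contDiff_smoothPart (hφ : IsRadialCutoff φ) : ContDiff ℝ (⊤ : ℕ∞) (smoothPart φ) := by
  rw [contDiff_iff_contDiffAt]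
  intro x
  by_cases hx : x = 0
  · subst hx
    refine (contDiffAt_const (c := (0 : ℝ))).congr_of_eventuallyEq ?_
    filter_upwards [ball_mem_nhds (0 : Plane) one_half_pos] with y hy
    rw [smoothPart, hφ.one y hy, sub_self, zero_div]
  · exact (contDiffAt_const.sub hφ.smooth.contDiffAt).div (contDiffAt_norm ℝ hx)
      (norm_ne_zero_iff.2 hx)

theorem smoothPart_eventuallyEq (hφ : IsRadialCutoff φ) {x : Plane} (hx : 1 < ‖x‖) :
    smoothPart φ =ᶠ[𝓝 x] fun y => ‖y‖⁻¹ := by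
  have : {y : Plane | 1 < ‖y‖} ∈ 𝓝 x := (isOpen_lt continuous_const continuous_norm).mem_nhds hx
  filter_upwards [this] with y hy
  rw [smoothPart, hφ.eq_zero (le_of_lt hy), sub_zero, one_div]

theorem exists_norm_smoothPart_le (hφ : IsRadialCutoff φ) :
    ∃ C : ℝ, ∀ x, ‖smoothPart φ x‖ ≤ C := by
  obtain ⟨C, hC⟩ := (isCompact_closedBall (0 : Plane) 1).exists_bound_of_continuousOn
    hφ.contDiff_smoothPart.continuous.continuousOn
  refine ⟨max C 1, fun x => ?_⟩
  by_cases hx : ‖x‖ ≤ 1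
  · exact (hC x (by simpa using hx)).trans (le_max_left _ _)
  · have hx := not_le.1 hx
    rw [(hφ.smoothPart_eventuallyEq hx).eq_of_nhds, norm_inv, norm_norm]
    exact (inv_le_one_of_one_le₀ hx.le).trans (le_max_right _ _)

/-- Outside the unit ball the function is `1/|x|`, with gradient of size at most `|x|⁻²`. This decay
puts the gradient in `L²`, which is all the error estimate needs. -/
theorem exists_norm_fderiv_smoothPart_le (hφ : IsRadialCutoff φ) :
    ∃ C : ℝ, ∀ x, ‖fderiv ℝ (smoothPart φ) x‖ ≤ C * (1 + ‖x‖ ^ 2)⁻¹ := by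
  obtain ⟨C, hC⟩ := (isCompact_closedBall (0 : Plane) 1).exists_bound_of_continuousOn
    (hφ.contDiff_smoothPart.continuous_fderiv (by simp)).continuousOn
  have hC0 : 0 ≤ C := (norm_nonneg _).trans (hC 0 (by simp))
  refine ⟨2 * C + 2, fun x => ?_⟩
  rw [← div_eq_mul_inv, le_div_iff₀ (by positivity)]
  by_cases hx : ‖x‖ ≤ 1
  · have h1 := hC x (by simpa using hx)
    have h2 : ‖x‖ ^ 2 ≤ 1 := pow_le_one₀ (norm_nonneg _) hx
    nlinarith [norm_nonneg (fderiv ℝ (smoothPart φ) x)]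
  · have hx := not_le.1 hx
    have hx0 : x ≠ 0 := norm_pos_iff.1 (one_pos.trans hx)
    have hd : HasFDerivAt (fun y : Plane => ‖y‖⁻¹) _ x :=
      (hasFDerivAt_inv (norm_ne_zero_iff.2 hx0)).comp x
        ((contDiffAt_norm ℝ hx0).differentiableAt one_ne_zero).hasFDerivAt
    rw [(hφ.smoothPart_eventuallyEq hx).fderiv_eq, hd.fderiv]
    have h3 : ‖fderiv ℝ (fun y : Plane => ‖y‖) x‖ ≤ 1 := by
      simpa using norm_fderiv_le_of_lipschitz ℝ (lipschitzWith_one_norm (E := Plane)) (x₀ := x)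
    have h4 : ‖(ContinuousLinearMap.toSpanSingleton ℝ (-(‖x‖ ^ 2)⁻¹)).comp
        (fderiv ℝ (fun y : Plane => ‖y‖) x)‖ ≤ (‖x‖ ^ 2)⁻¹ * 1 := by
      refine (ContinuousLinearMap.opNorm_comp_le _ _).trans ?_
      gcongr
      rw [ContinuousLinearMap.norm_toSpanSingleton, norm_neg, Real.norm_of_nonneg (by positivity)]
    refine (mul_le_mul_of_nonneg_right h4 (by positivity)).trans ?_
    have h5 : (‖x‖ ^ 2)⁻¹ ≤ 1 := inv_le_one_of_one_le₀ (one_le_pow₀ hx.le)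
    have h6 : (‖x‖ ^ 2)⁻¹ * ‖x‖ ^ 2 = 1 := inv_mul_cancel₀ (by positivity)
    nlinarith

theorem memLp_fderiv_smoothPart (hφ : IsRadialCutoff φ) :
    MemLp (fderiv ℝ (smoothPart φ)) 2 volume := by
  obtain ⟨C, hC⟩ := hφ.exists_norm_fderiv_smoothPart_le
  have hc : Continuous (fderiv ℝ (smoothPart φ)) :=
    hφ.contDiff_smoothPart.continuous_fderiv (by simp)
  rw [memLp_two_iff_integrable_sq_norm hc.aestronglyMeasurable]
  have hi : Integrable fun x : Plane => (1 + ‖x‖ ^ 2) ^ (-(4 : ℝ) / 2) :=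
    integrable_rpow_neg_one_add_norm_sq (by simp; norm_num)
  refine (hi.const_mul (C ^ 2)).mono' (hc.norm.pow 2).aestronglyMeasurable
    (Eventually.of_forall fun x => ?_)
  rw [Real.norm_of_nonneg (by positivity), show -(4 : ℝ) / 2 = -(2 : ℕ) by norm_num,
    Real.rpow_neg (by positivity), Real.rpow_natCast, ← inv_pow, ← mul_pow]
  gcongr
  exact hC x

/-- The derivative is put on the smooth part and not on the kernel, so the resulting bounds do not
blow up as `s → 0`. -/
theorem hasFDerivAt_heatFlow_smoothPart (hφ : IsRadialCutoff φ) {s : ℝ} (hs : 0 < s) (x : Plane) :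
    HasFDerivAt (heatFlow s (smoothPart φ)) (heatFlow s (fderiv ℝ (smoothPart φ)) x) x := by
  obtain ⟨C, hC⟩ := hφ.exists_norm_smoothPart_le
  obtain ⟨C', hC'⟩ := hφ.exists_norm_fderiv_smoothPart_le
  have hC0 : 0 ≤ C' := by simpa using (norm_nonneg _).trans (hC' 0)
  exact hasFDerivAt_integral_mul_translate (hφ.contDiff_smoothPart.of_le (by simp)) hC
    (C' := C') (fun x => (hC' x).trans (mul_le_of_le_one_right hC0 (inv_le_one_of_one_le₀
      (by nlinarith [sq_nonneg ‖x‖])))) (integrable_gaussKernel hs) x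

theorem heatFlow_singularVorticity (hφ : IsRadialCutoff φ) {s : ℝ} (hs : 0 < s) (x : Plane) :
    heatFlow s (singularVorticity φ) x = 2 * √Real.pi * (∫ α : ℝ, gaussKernel (α ^ 2 + s) x) -
      heatFlow s (smoothPart φ) x := by
  obtain ⟨C, hC⟩ := hφ.exists_norm_smoothPart_le
  rw [← integral_gaussKernel_mul_inv_norm hs, heatFlow_apply', heatFlow_apply', ← integral_sub
    (integrable_gaussKernel_mul_inv_norm hs x)]
  · refine integral_congr_ae (Eventually.of_forall fun y => ?_)
    simp only [singularVorticity, smoothPart, smul_eq_mul]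
    ring
  · exact ((integrable_gaussKernel hs).comp_sub_left x).mul_bdd
      hφ.contDiff_smoothPart.continuous.aestronglyMeasurable (Eventually.of_forall hC)

theorem hasFDerivAt_heatFlow (hφ : IsRadialCutoff φ) {s : ℝ} (hs : 0 < s) (x : Plane) :
    HasFDerivAt (heatFlow s (singularVorticity φ))
      ((2 * √Real.pi) • (-gradProfile s x • innerSL ℝ x) -
        heatFlow s (fderiv ℝ (smoothPart φ)) x) x := by
  have h := ((hasFDerivAt_integral_gaussKernel hs x).const_mul (2 * √Real.pi)).sub
    (hφ.hasFDerivAt_heatFlow_smoothPart hs x)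
  exact h.congr_of_eventuallyEq (Eventually.of_forall fun y => hφ.heatFlow_singularVorticity hs y)

end IsRadialCutoff

/-! ### Concentration of the dissipation density at the origin -/

theorem norm_gradient (f : Plane → ℝ) (x : Plane) : ‖∇ f x‖ = ‖fderiv ℝ f x‖ :=
  LinearIsometryEquiv.norm_map _ _

/-- The dissipation density of the heat flow of `1 / |x|` at time `s`. -/
def singularDissipation (s : ℝ) (x : Plane) : ℝ :=
  s * ‖(2 * √Real.pi) • (-gradProfile s x • innerSL ℝ x)‖ ^ 2

theorem singularDissipation_scale {s : ℝ} (hs : 0 < s) (z : Plane) :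
    singularDissipation s (√s • z) = s⁻¹ * enstrophyProfile z := by
  have h2 : √s ^ 2 = s := Real.sq_sqrt hs.le
  have h3 : √Real.pi ^ 2 = Real.pi := Real.sq_sqrt Real.pi_pos.le
  rw [singularDissipation, gradProfile_scale hs, norm_smul, norm_smul, innerSL_apply_norm,
    norm_smul, enstrophyProfile]
  simp only [mul_pow, norm_neg, norm_mul, Real.norm_eq_abs, sq_abs]
  rw [h2, h3]
  field_simp
  ring

theorem integrable_singularDissipation {s : ℝ} (hs : 0 < s) :
    Integrable (singularDissipation s) := by
  rw [← integrable_comp_smul_iff volume _ (Real.sqrt_pos.2 hs).ne']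
  simp only [singularDissipation_scale hs]
  exact integrable_enstrophyProfile.const_mul _

theorem integral_singularDissipation_mul {s : ℝ} (hs : 0 < s) (ψ : Plane → ℝ) :
    ∫ x, singularDissipation s x * ψ x = ∫ z, enstrophyProfile z * ψ (√s • z) := by
  have h := Measure.integral_comp_smul (volume : Measure Plane)
    (fun x => singularDissipation s x * ψ x) (√s)
  simp only [singularDissipation_scale hs, mul_assoc] at h
  rw [integral_const_mul, finrank_euclideanSpace_fin, Real.sq_sqrt hs.le, abs_of_pos (by positivity),
    smul_eq_mul] at h
  exact (mul_left_cancel₀ (inv_ne_zero hs.ne') h).symm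

/-- By self-similarity the density is an approximate identity of mass `π/2`. Boundedness of `ψ`
replaces compact support, so that `ψ = 1` is allowed when the `L¹` norm is computed. -/
theorem tendsto_integral_singularDissipation_mul {ψ : Plane → ℝ} (hψ : Continuous ψ) {B : ℝ}
    (hB : ∀ x, ‖ψ x‖ ≤ B) :
    Tendsto (fun s => ∫ x, singularDissipation s x * ψ x) (𝓝[>] 0) (𝓝 (Real.pi / 2 * ψ 0)) := by
  rw [← integral_enstrophyProfile, ← integral_mul_const]
  refine Tendsto.congr' (f₁ := fun s => ∫ z, enstrophyProfile z * ψ (√s • z)) ?_ ?_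
  · filter_upwards [self_mem_nhdsWithin] with s hs using (integral_singularDissipation_mul hs ψ).symm
  · refine tendsto_integral_filter_of_dominated_convergence (fun z => ‖enstrophyProfile z‖ * B)
      (Eventually.of_forall fun s => ?_) (Eventually.of_forall fun s => Eventually.of_forall fun z => ?_)
      (integrable_enstrophyProfile.norm.mul_const B) (Eventually.of_forall fun z => ?_)
    · exact integrable_enstrophyProfile.1.mul (hψ.comp (by fun_prop)).aestronglyMeasurable
    · rw [norm_mul]
      gcongr
      exact hB _
    · refine Tendsto.const_mul _ ?_
      have : Continuous fun s : ℝ => ψ (√s • z) := hψ.comp (by fun_prop)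
      simpa using (this.tendsto 0).mono_left nhdsWithin_le_nhds

namespace IsRadialCutoff

variable {φ : Plane → ℝ}

theorem viscousDensity_eq (hφ : IsRadialCutoff φ) {s : ℝ} (hs : 0 < s) (x : Plane) :
    viscousDensity s (heatFlow s (singularVorticity φ)) x =
      s * ‖(2 * √Real.pi) • (-gradProfile s x • innerSL ℝ x) -
        heatFlow s (fderiv ℝ (smoothPart φ)) x‖ ^ 2 := by
  rw [viscousDensity, norm_gradient, (hφ.hasFDerivAt_heatFlow hs x).fderiv]

theorem continuous_viscousDensity (hφ : IsRadialCutoff φ) {s : ℝ} (hs : 0 < s) :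
    Continuous (viscousDensity s (heatFlow s (singularVorticity φ))) := by
  have h := contDiff_heatFlow hφ.integrable_singularVorticity
    hφ.hasCompactSupport_singularVorticity hs
  have h2 := h.continuous_fderiv (by simp)
  unfold viscousDensity
  simp only [norm_gradient]
  fun_prop

/-- Expand `‖v - e‖²`, where `v` is the singular gradient and `e` the smooth one. The singular term
has `s ‖v‖²` of mass `π/2`, so the cross term must be split with a weight that leaves a small factor
on both sides. -/
theorem abs_viscousDensity_sub_le (hφ : IsRadialCutoff φ) {s : ℝ} (hs : 0 < s) (x : Plane) :
    |viscousDensity s (heatFlow s (singularVorticity φ)) x - singularDissipation s x| ≤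
      √s * singularDissipation s x +
        (s + √s) * ‖heatFlow s (fderiv ℝ (smoothPart φ)) x‖ ^ 2 := by
  have hr : 0 < √s := Real.sqrt_pos.2 hs
  have h2 : √s ^ 2 = s := Real.sq_sqrt hs.le
  rw [hφ.viscousDensity_eq hs, singularDissipation]
  generalize (2 * √Real.pi) • (-gradProfile s x • innerSL ℝ x) = v
  generalize heatFlow s (fderiv ℝ (smoothPart φ)) x = e
  have h3 := norm_sub_le v e
  have h4 : ‖v‖ - ‖e‖ ≤ ‖v - e‖ := norm_sub_norm_le v e
  have h5 : ‖e‖ - ‖v‖ ≤ ‖v - e‖ := by rw [norm_sub_rev]; exact norm_sub_norm_le e v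
  have h6 : |‖v - e‖ ^ 2 - ‖v‖ ^ 2| ≤ ‖e‖ ^ 2 + 2 * (‖v‖ * ‖e‖) := by
    rw [abs_le]
    have := norm_nonneg v
    have := norm_nonneg e
    have := norm_nonneg (v - e)
    constructor
    · have : |‖v‖ - ‖e‖| ≤ ‖v - e‖ := abs_le.2 ⟨by linarith, h4⟩
      have := sq_le_sq' (by linarith [abs_nonneg (‖v‖ - ‖e‖)]) this
      rw [sq_abs] at this
      nlinarith
    · nlinarith
  rw [← mul_sub, abs_mul, abs_of_pos hs]
  -- Weighted Young inequality, from `√s (√s ‖v‖ - ‖e‖)² ≥ 0`.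
  have h7 : s * (2 * (‖v‖ * ‖e‖)) ≤ √s * (s * ‖v‖ ^ 2) + √s * ‖e‖ ^ 2 := by
    have h8 : 0 ≤ √s * (√s * ‖v‖ - ‖e‖) ^ 2 := by positivity
    have h9 : √s * (√s * ‖v‖ - ‖e‖) ^ 2 =
        √s * (√s ^ 2 * ‖v‖ ^ 2) + √s * ‖e‖ ^ 2 - √s ^ 2 * (2 * (‖v‖ * ‖e‖)) := by ring
    rw [h9, h2] at h8
    linarith
  nlinarith

theorem memLp_heatFlow_fderiv_smoothPart (hφ : IsRadialCutoff φ) {s : ℝ} (hs : 0 < s) :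
    MemLp (heatFlow s (fderiv ℝ (smoothPart φ))) 2 volume := by
  have h1 : heatFlow s (fderiv ℝ (smoothPart φ)) = fderiv ℝ (heatFlow s (smoothPart φ)) :=
    funext fun x => (hφ.hasFDerivAt_heatFlow_smoothPart hs x).fderiv.symm
  refine ⟨?_, (eLpNorm_heatFlow_le hs (by simp) (by simp)
    hφ.memLp_fderiv_smoothPart.1).trans_lt hφ.memLp_fderiv_smoothPart.2⟩
  rw [h1]
  exact (measurable_fderiv ℝ _).aestronglyMeasurable

theorem integral_norm_sq_heatFlow_fderiv_le (hφ : IsRadialCutoff φ) {s : ℝ} (hs : 0 < s) :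
    ∫ x, ‖heatFlow s (fderiv ℝ (smoothPart φ)) x‖ ^ 2 ≤ ∫ x, ‖fderiv ℝ (smoothPart φ) x‖ ^ 2 := by
  have h1 := hφ.memLp_fderiv_smoothPart
  have h2 := hφ.memLp_heatFlow_fderiv_smoothPart hs
  have h3 := eLpNorm_heatFlow_le hs (p := 2) (by simp) (by simp) h1.1
  have key : ∀ {f : Plane → (Plane →L[ℝ] ℝ)}, MemLp f 2 volume →
      ∫ x, ‖f x‖ ^ 2 = (eLpNorm f 2 volume ^ (2 : ℝ)).toReal := fun {f} hf => by
    have h4 := eLpNorm_rpow_eq_lintegral (p := 2) (ν := volume) (by simp) (by simp) f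
    simp only [ENNReal.toReal_ofNat] at h4
    have h5 : AEStronglyMeasurable (fun x => ‖f x‖ ^ 2) volume := hf.1.norm.pow 2
    rw [h4, integral_eq_lintegral_of_nonneg_ae (Eventually.of_forall fun x => by positivity) h5]
    congr 1
    refine lintegral_congr fun x => ?_
    rw [ENNReal.rpow_two, ← ofReal_norm, ENNReal.ofReal_pow (norm_nonneg _)]
  rw [key h1, key h2]
  refine ENNReal.toReal_mono ?_ ?_
  · exact ENNReal.rpow_ne_top_of_nonneg (by norm_num) h1.2.ne
  · gcongr

theorem integrable_viscousDensity (hφ : IsRadialCutoff φ) {s : ℝ} (hs : 0 < s) :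
    Integrable (viscousDensity s (heatFlow s (singularVorticity φ))) := by
  have h1 := integrable_singularDissipation hs
  have h2 : Integrable fun x => ‖heatFlow s (fderiv ℝ (smoothPart φ)) x‖ ^ 2 :=
    (memLp_two_iff_integrable_sq_norm (hφ.memLp_heatFlow_fderiv_smoothPart hs).1).1
      (hφ.memLp_heatFlow_fderiv_smoothPart hs)
  have h3 : Integrable fun x => viscousDensity s (heatFlow s (singularVorticity φ)) x -
      singularDissipation s x :=
    ((h1.const_mul (√s)).add (h2.const_mul (s + √s))).mono'
      ((hφ.continuous_viscousDensity hs).aestronglyMeasurable.sub h1.1)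
      (Eventually.of_forall fun x => hφ.abs_viscousDensity_sub_le hs x)
  refine (h3.add h1).congr (Eventually.of_forall fun x => ?_)
  simp

theorem integral_abs_viscousDensity_sub_le (hφ : IsRadialCutoff φ) {s : ℝ} (hs : 0 < s) :
    ∫ x, |viscousDensity s (heatFlow s (singularVorticity φ)) x - singularDissipation s x| ≤
      √s * (Real.pi / 2) + (s + √s) * ∫ x, ‖fderiv ℝ (smoothPart φ) x‖ ^ 2 := by
  have h1 := integrable_singularDissipation hs
  have h2 : Integrable fun x => ‖heatFlow s (fderiv ℝ (smoothPart φ)) x‖ ^ 2 :=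
    (memLp_two_iff_integrable_sq_norm (hφ.memLp_heatFlow_fderiv_smoothPart hs).1).1
      (hφ.memLp_heatFlow_fderiv_smoothPart hs)
  have h4 : ∫ x, singularDissipation s x = Real.pi / 2 := by
    have := integral_singularDissipation_mul hs (fun _ => 1)
    simpa [integral_enstrophyProfile] using this
  calc _ ≤ ∫ x, (√s * singularDissipation s x +
        (s + √s) * ‖heatFlow s (fderiv ℝ (smoothPart φ)) x‖ ^ 2) :=
        integral_mono ((hφ.integrable_viscousDensity hs).sub h1).abs
          ((h1.const_mul _).add (h2.const_mul _)) fun x => hφ.abs_viscousDensity_sub_le hs x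
    _ = √s * (Real.pi / 2) + (s + √s) * ∫ x, ‖heatFlow s (fderiv ℝ (smoothPart φ)) x‖ ^ 2 := by
        rw [integral_add (h1.const_mul _) (h2.const_mul _), integral_const_mul, integral_const_mul,
          h4]
    _ ≤ _ := by
        exact add_le_add le_rfl (mul_le_mul_of_nonneg_left
          (hφ.integral_norm_sq_heatFlow_fderiv_le hs) (by positivity))

theorem viscousDensity_nonneg {s : ℝ} (hs : 0 ≤ s) (ω : Plane → ℝ) (x : Plane) :
    0 ≤ viscousDensity s ω x := by
  unfold viscousDensity; positivity

/-- The dissipation density of the heat flow of the singular vorticity concentrates at the origin,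
with mass `π / 2`. -/
theorem tendsto_integral_viscousDensity_mul (hφ : IsRadialCutoff φ) {ψ : Plane → ℝ}
    (hψ : Continuous ψ) {B : ℝ} (hB : ∀ x, ‖ψ x‖ ≤ B) :
    Tendsto (fun s => ∫ x, viscousDensity s (heatFlow s (singularVorticity φ)) x * ψ x)
      (𝓝[>] 0) (𝓝 (Real.pi / 2 * ψ 0)) := by
  have hB0 : 0 ≤ B := (norm_nonneg _).trans (hB 0)
  have h0 : Tendsto (fun s : ℝ => (√s * (Real.pi / 2) +
      (s + √s) * ∫ x, ‖fderiv ℝ (smoothPart φ) x‖ ^ 2) * B) (𝓝[>] 0) (𝓝 0) := by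
    have : Continuous fun s : ℝ => (√s * (Real.pi / 2) +
      (s + √s) * ∫ x, ‖fderiv ℝ (smoothPart φ) x‖ ^ 2) * B := by fun_prop
    simpa using (this.tendsto 0).mono_left nhdsWithin_le_nhds
  have h1 : Tendsto (fun s => ∫ x, (viscousDensity s (heatFlow s (singularVorticity φ)) x -
      singularDissipation s x) * ψ x) (𝓝[>] 0) (𝓝 0) := by
    refine squeeze_zero_norm' ?_ h0
    filter_upwards [self_mem_nhdsWithin] with s hs
    refine (norm_integral_le_integral_norm _).trans ?_
    refine le_trans ?_ (mul_le_mul_of_nonneg_right (hφ.integral_abs_viscousDensity_sub_le hs) hB0)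
    rw [← integral_mul_const]
    have hi := (hφ.integrable_viscousDensity hs).sub (integrable_singularDissipation hs)
    refine integral_mono_of_nonneg (Eventually.of_forall fun x => norm_nonneg _)
      (hi.abs.mul_const B) (Eventually.of_forall fun x => ?_)
    simp only [norm_mul]
    exact mul_le_mul_of_nonneg_left (hB x) (abs_nonneg _)
  have h2 := h1.add (tendsto_integral_singularDissipation_mul hψ hB)
  rw [zero_add] at h2
  refine h2.congr' ?_
  filter_upwards [self_mem_nhdsWithin] with s hs
  have hi := hφ.integrable_viscousDensity hs
  have hi' := integrable_singularDissipation hs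
  rw [← integral_add]
  · refine integral_congr_ae (Eventually.of_forall fun x => ?_)
    simp only
    ring
  · exact (hi.sub hi').mul_bdd hψ.aestronglyMeasurable (Eventually.of_forall hB)
  · exact hi'.mul_bdd hψ.aestronglyMeasurable (Eventually.of_forall hB)

/-- Supplies the dominating function when the limit is taken under the time integral. -/
theorem exists_integral_viscousDensity_le (hφ : IsRadialCutoff φ) (S : ℝ) :
    ∃ C : ℝ, ∀ s : ℝ, 0 < s → s ≤ S →
      ∫ x, viscousDensity s (heatFlow s (singularVorticity φ)) x ≤ C := by
  refine ⟨√S * (Real.pi / 2) + (S + √S) * (∫ x, ‖fderiv ℝ (smoothPart φ) x‖ ^ 2) + Real.pi / 2,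
    fun s hs hS => ?_⟩
  have hi := hφ.integrable_viscousDensity hs
  have hi' := integrable_singularDissipation hs
  have h4 : ∫ x, singularDissipation s x = Real.pi / 2 := by
    have := integral_singularDissipation_mul hs (fun _ => 1)
    simpa [integral_enstrophyProfile] using this
  have h5 : ∫ x, (viscousDensity s (heatFlow s (singularVorticity φ)) x - singularDissipation s x) ≤
      ∫ x, |viscousDensity s (heatFlow s (singularVorticity φ)) x - singularDissipation s x| :=
    integral_mono (hi.sub hi') (hi.sub hi').abs fun x => le_abs_self _
  rw [integral_sub hi hi', h4] at h5
  have h6 := hφ.integral_abs_viscousDensity_sub_le hs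
  have h7 : √s * (Real.pi / 2) + (s + √s) * (∫ x, ‖fderiv ℝ (smoothPart φ) x‖ ^ 2) ≤
      √S * (Real.pi / 2) + (S + √S) * (∫ x, ‖fderiv ℝ (smoothPart φ) x‖ ^ 2) := by
    have : 0 ≤ ∫ x, ‖fderiv ℝ (smoothPart φ) x‖ ^ 2 := integral_nonneg fun x => by positivity
    have := Real.pi_pos
    gcongr
  linarith

end IsRadialCutoff

/-! ### The velocity of the singular vorticity -/

theorem measurable_biotSavartKernel : Measurable biotSavartKernel := by
  unfold biotSavartKernel
  have := continuous_perp.measurable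
  fun_prop

theorem norm_biotSavartKernel (x : Plane) : ‖biotSavartKernel x‖ = (2 * Real.pi)⁻¹ * ‖x‖⁻¹ := by
  have hpi := Real.pi_pos
  rw [biotSavartKernel, norm_smul, norm_perp, Real.norm_of_nonneg (by positivity)]
  by_cases hx : ‖x‖ = 0
  · simp [hx]
  · field_simp

theorem aestronglyMeasurable_velocity {ω : Plane → ℝ} (hω : AEStronglyMeasurable ω volume) :
    AEStronglyMeasurable (velocity ω) volume :=
  (hω.convolution_integrand (smulBil Plane)
    measurable_biotSavartKernel.aestronglyMeasurable).integral_prod_right'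

theorem integrable_indicator_norm_rpow {α : ℝ} (hα : α < 2) :
    Integrable ((ball (0 : Plane) 1).indicator fun x => ‖x‖ ^ (-α)) := by
  rw [integrable_indicator_iff measurableSet_ball]
  refine integrableOn_ball_of_norm_le_rpow (C := 1) (α := α) (by simp)
    (by rwa [finrank_euclideanSpace_fin]) (Eventually.of_forall fun x => ?_)
    (measurable_norm.pow_const _).aestronglyMeasurable
  rw [one_mul, Real.norm_of_nonneg (by positivity)]

/-- Within distance `1` of `x` use the bound on `ω` and local integrability of the kernel; farther
away use integrability of `ω` and boundedness of the kernel. -/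
theorem velocityExistsAt_of_bounded {ω : Plane → ℝ} (hi : Integrable ω) {M : ℝ}
    (hM : ∀ x, ‖ω x‖ ≤ M) (x : Plane) : VelocityExistsAt ω x := by
  have hM0 : 0 ≤ M := (norm_nonneg _).trans (hM 0)
  have h1 := (integrable_indicator_norm_rpow (α := 1) (by norm_num)).comp_sub_left x
  refine ((h1.const_mul (M * (2 * Real.pi)⁻¹)).add (hi.norm.mul_const (2 * Real.pi)⁻¹)).mono'
    (hi.1.smul (measurable_biotSavartKernel.comp (by fun_prop)).aestronglyMeasurable)
    (Eventually.of_forall fun y => ?_)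
  change ‖ω y • biotSavartKernel (x - y)‖ ≤ _
  have hpi := Real.pi_pos
  rw [norm_smul, norm_biotSavartKernel]
  simp only [Pi.add_apply]
  by_cases hy : x - y ∈ ball (0 : Plane) 1
  · rw [indicator_of_mem hy, Real.rpow_neg_one, mul_assoc]
    refine (mul_le_mul_of_nonneg_right (hM y) (by positivity)).trans ?_
    exact le_add_of_nonneg_right (by positivity)
  · rw [indicator_of_notMem hy, mul_zero, zero_add]
    rw [mem_ball_zero_iff, not_lt] at hy
    gcongr
    exact mul_le_of_le_one_right (by positivity) (inv_le_one_of_one_le₀ hy)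

/-- Split `b⁻¹` into two square roots: one is bounded through `b ≥ a`, the other through `b ≥ r/2`.
The power `3/2` that remains on `a` is below the dimension, hence locally integrable. -/
theorem inv_mul_inv_le_of_le {a b r : ℝ} (ha : 0 < a) (hr : 0 < r) (hab : a ≤ b)
    (h : r ≤ a + b) : a⁻¹ * b⁻¹ ≤ 2 * r ^ (-(1 / 2) : ℝ) * a ^ (-(3 / 2) : ℝ) := by
  have hb : 0 < b := ha.trans_le hab
  have h1 : a⁻¹ * b⁻¹ = a⁻¹ * b ^ (-(1 / 2) : ℝ) * b ^ (-(1 / 2) : ℝ) := by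
    rw [mul_assoc, ← Real.rpow_add hb]
    norm_num [Real.rpow_neg_one]
  have h2 : a ^ (-(3 / 2) : ℝ) = a⁻¹ * a ^ (-(1 / 2) : ℝ) := by
    rw [← Real.rpow_neg_one a, ← Real.rpow_add ha]
    norm_num
  have h3 : b ^ (-(1 / 2) : ℝ) ≤ a ^ (-(1 / 2) : ℝ) :=
    Real.rpow_le_rpow_of_nonpos ha hab (by norm_num)
  have h4 : b ^ (-(1 / 2) : ℝ) ≤ (r / 2) ^ (-(1 / 2) : ℝ) :=
    Real.rpow_le_rpow_of_nonpos (by positivity) (by linarith) (by norm_num)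
  have h5 : (r / 2) ^ (-(1 / 2) : ℝ) ≤ 2 * r ^ (-(1 / 2) : ℝ) := by
    rw [Real.div_rpow hr.le (by norm_num), div_eq_mul_inv, mul_comm]
    gcongr
    rw [← Real.rpow_neg (by norm_num), neg_neg]
    calc (2 : ℝ) ^ (1 / 2 : ℝ) ≤ 2 ^ (1 : ℝ) :=
          Real.rpow_le_rpow_of_exponent_le (by norm_num) (by norm_num)
      _ = 2 := Real.rpow_one 2
  rw [h1, h2]
  calc a⁻¹ * b ^ (-(1 / 2) : ℝ) * b ^ (-(1 / 2) : ℝ)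
      ≤ a⁻¹ * a ^ (-(1 / 2) : ℝ) * (2 * r ^ (-(1 / 2) : ℝ)) := by
        gcongr
        exact h4.trans h5
    _ = _ := by ring

theorem inv_norm_mul_inv_norm_le {x : Plane} (hx : x ≠ 0) (y : Plane) :
    ‖y‖⁻¹ * ‖x - y‖⁻¹ ≤
      2 * ‖x‖ ^ (-(1 / 2) : ℝ) * (‖y‖ ^ (-(3 / 2) : ℝ) + ‖x - y‖ ^ (-(3 / 2) : ℝ)) := by
  by_cases hy : ‖y‖ = 0
  · rw [hy, inv_zero, zero_mul]; positivity
  by_cases hxy : ‖x - y‖ = 0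
  · rw [hxy, inv_zero, mul_zero]; positivity
  have hy' : 0 < ‖y‖ := lt_of_le_of_ne (norm_nonneg _) (Ne.symm hy)
  have hxy' : 0 < ‖x - y‖ := lt_of_le_of_ne (norm_nonneg _) (Ne.symm hxy)
  have hr : 0 < ‖x‖ := norm_pos_iff.2 hx
  have htri : ‖x‖ ≤ ‖y‖ + ‖x - y‖ := by
    calc ‖x‖ = ‖y + (x - y)‖ := by congr 1; abel
      _ ≤ _ := norm_add_le _ _
  have hp1 : 0 ≤ ‖y‖ ^ (-(3 / 2) : ℝ) := by positivity
  have hp2 : 0 ≤ ‖x - y‖ ^ (-(3 / 2) : ℝ) := by positivity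
  rcases le_total ‖y‖ ‖x - y‖ with h | h
  · refine (inv_mul_inv_le_of_le hy' hr h htri).trans ?_
    gcongr
    linarith
  · rw [mul_comm ‖y‖⁻¹]
    refine (inv_mul_inv_le_of_le hxy' hr h (by linarith)).trans ?_
    gcongr
    linarith

namespace IsRadialCutoff

variable {φ : Plane → ℝ}

/-- The rate `|x|^(-1/2)` is not sharp but suffices: its square is locally integrable, its product
with `|x|⁻¹` is locally integrable, and it is bounded away from the origin. -/
theorem exists_velocity_bound (hφ : IsRadialCutoff φ) : ∃ C : ℝ, 0 ≤ C ∧ ∀ x : Plane, x ≠ 0 →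
    VelocityExistsAt (singularVorticity φ) x ∧
      ‖velocity (singularVorticity φ) x‖ ≤ C * ‖x‖ ^ (-(1 / 2) : ℝ) := by
  obtain ⟨B, hB0, -, hB⟩ := hφ.exists_bound
  have hpi := Real.pi_pos
  set k : Plane → ℝ := (ball (0 : Plane) 1).indicator fun x => ‖x‖ ^ (-(3 / 2) : ℝ) with hk
  have hki : Integrable k := integrable_indicator_norm_rpow (by norm_num)
  have hk0 : ∀ y, 0 ≤ k y := fun y => indicator_nonneg (fun y _ => by positivity) y
  -- `c` covers the points `y` of the unit ball with `‖x - y‖ ≥ 1`, where `k (x - y)` vanishes but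
  -- the power is at most `1`.
  set c : Plane → ℝ := (ball (0 : Plane) 1).indicator fun _ => (1 : ℝ) with hc
  have hci : Integrable c := (integrable_indicator_iff measurableSet_ball).2
    (integrableOn_const measure_ball_lt_top.ne)
  have hD : ∀ x : Plane, Integrable fun y => k y + k (x - y) + c y := fun x =>
    (hki.add (hki.comp_sub_left x)).add hci
  have hDint : ∀ x : Plane, ∫ y, (k y + k (x - y) + c y) = 2 * (∫ y, k y) + ∫ y, c y := fun x => by
    have h1 := integral_add (hki.add (hki.comp_sub_left x)) hci
    have h2 := integral_add hki (hki.comp_sub_left x)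
    simp only [Pi.add_apply] at h1 h2
    rw [h1, h2, integral_sub_left_eq_self k volume x]
    ring
  have hle : ∀ x : Plane, x ≠ 0 → ∀ y, ‖singularVorticity φ y • biotSavartKernel (x - y)‖ ≤
      (B * (2 * Real.pi)⁻¹ * 2 * ‖x‖ ^ (-(1 / 2) : ℝ)) * (k y + k (x - y) + c y) := by
    intro x hx y
    by_cases hy : y ∈ ball (0 : Plane) 1
    · have h1 : ‖x - y‖ ^ (-(3 / 2) : ℝ) ≤ k (x - y) + c y := by
        simp only [hc, indicator_of_mem hy]
        by_cases hxy : x - y ∈ ball (0 : Plane) 1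
        · simp only [hk, indicator_of_mem hxy]; linarith
        · simp only [hk, indicator_of_notMem hxy, zero_add]
          rw [mem_ball_zero_iff, not_lt] at hxy
          exact Real.rpow_le_one_of_one_le_of_nonpos hxy (by norm_num)
      have h2 : ‖y‖ ^ (-(3 / 2) : ℝ) = k y := by simp only [hk, indicator_of_mem hy]
      rw [norm_smul, norm_biotSavartKernel]
      calc ‖singularVorticity φ y‖ * ((2 * Real.pi)⁻¹ * ‖x - y‖⁻¹)
          ≤ (B * ‖y‖⁻¹) * ((2 * Real.pi)⁻¹ * ‖x - y‖⁻¹) := by gcongr; exact hB y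
        _ = B * (2 * Real.pi)⁻¹ * (‖y‖⁻¹ * ‖x - y‖⁻¹) := by ring
        _ ≤ B * (2 * Real.pi)⁻¹ * (2 * ‖x‖ ^ (-(1 / 2) : ℝ) *
            (‖y‖ ^ (-(3 / 2) : ℝ) + ‖x - y‖ ^ (-(3 / 2) : ℝ))) := by
            exact mul_le_mul_of_nonneg_left (inv_norm_mul_inv_norm_le hx y) (by positivity)
        _ ≤ B * (2 * Real.pi)⁻¹ * (2 * ‖x‖ ^ (-(1 / 2) : ℝ) * (k y + (k (x - y) + c y))) := by
            rw [h2]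
            gcongr
        _ = _ := by ring
    · rw [hφ.singularVorticity_eq_zero (by simpa using hy), zero_smul, norm_zero]
      have := hk0 y
      have := hk0 (x - y)
      have : 0 ≤ c y := indicator_nonneg (fun y _ => zero_le_one) y
      positivity
  refine ⟨B * (2 * Real.pi)⁻¹ * 2 * (2 * (∫ y, k y) + ∫ y, c y), ?_, fun x hx => ⟨?_, ?_⟩⟩
  · have : 0 ≤ ∫ y, k y := integral_nonneg hk0
    have : 0 ≤ ∫ y, c y := integral_nonneg fun y => indicator_nonneg (fun y _ => zero_le_one) y
    positivity
  · refine ((hD x).const_mul _).mono' ?_ (Eventually.of_forall (hle x hx))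
    exact hφ.measurable_singularVorticity.aestronglyMeasurable.smul
      (measurable_biotSavartKernel.comp (by fun_prop)).aestronglyMeasurable
  · refine (norm_integral_le_of_norm_le ((hD x).const_mul _)
      (Eventually.of_forall (hle x hx))).trans ?_
    rw [integral_const_mul, hDint]
    exact le_of_eq (by ring)

theorem aestronglyMeasurable_velocity_singularVorticity (hφ : IsRadialCutoff φ) :
    AEStronglyMeasurable (velocity (singularVorticity φ)) volume :=
  aestronglyMeasurable_velocity hφ.measurable_singularVorticity.aestronglyMeasurable

theorem memLp_velocity_indicator (hφ : IsRadialCutoff φ) :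
    MemLp ((ball (0 : Plane) 1).indicator (velocity (singularVorticity φ))) 2 volume := by
  obtain ⟨C, hC0, hC⟩ := hφ.exists_velocity_bound
  have hm := hφ.aestronglyMeasurable_velocity_singularVorticity.indicator
    (measurableSet_ball (x := (0 : Plane)) (ε := 1))
  rw [memLp_two_iff_integrable_sq_norm hm]
  refine ((integrable_indicator_norm_rpow (α := 1) (by norm_num)).const_mul (C ^ 2)).mono'
    (hm.norm.pow 2) ?_
  filter_upwards [ae_ne_zero_plane] with x hx
  by_cases hxb : x ∈ ball (0 : Plane) 1
  · rw [indicator_of_mem hxb, indicator_of_mem hxb, Real.norm_of_nonneg (by positivity)]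
    refine (pow_le_pow_left₀ (norm_nonneg _) (hC x hx).2 2).trans (le_of_eq ?_)
    rw [mul_pow, ← Real.rpow_natCast (‖x‖ ^ (-(1 / 2) : ℝ)), ← Real.rpow_mul (norm_nonneg _)]
    norm_num
  · simp [indicator_of_notMem hxb]

theorem memLp_top_velocity_indicator (hφ : IsRadialCutoff φ) :
    MemLp ((ball (0 : Plane) 1)ᶜ.indicator (velocity (singularVorticity φ))) ∞ volume := by
  obtain ⟨C, hC0, hC⟩ := hφ.exists_velocity_bound
  refine memLp_top_of_bound (hφ.aestronglyMeasurable_velocity_singularVorticity.indicator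
    measurableSet_ball.compl) C (Eventually.of_forall fun x => ?_)
  by_cases hxb : x ∈ (ball (0 : Plane) 1)ᶜ
  · rw [indicator_of_mem hxb]
    have hx1 : 1 ≤ ‖x‖ := by simpa using hxb
    refine (hC x (norm_pos_iff.1 (one_pos.trans_le hx1))).2.trans ?_
    exact mul_le_of_le_one_right hC0 (Real.rpow_le_one_of_one_le_of_nonpos hx1 (by norm_num))
  · rw [indicator_of_notMem hxb, norm_zero]
    exact hC0

theorem integrable_smul_velocity (hφ : IsRadialCutoff φ) :
    Integrable fun x => singularVorticity φ x • velocity (singularVorticity φ) x := by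
  obtain ⟨B, hB0, -, hB⟩ := hφ.exists_bound
  obtain ⟨C, hC0, hC⟩ := hφ.exists_velocity_bound
  refine ((integrable_indicator_norm_rpow (α := 3 / 2) (by norm_num)).const_mul (B * C)).mono'
    (hφ.measurable_singularVorticity.aestronglyMeasurable.smul
      hφ.aestronglyMeasurable_velocity_singularVorticity) ?_
  filter_upwards [ae_ne_zero_plane] with x hx
  by_cases hxb : x ∈ ball (0 : Plane) 1
  · rw [indicator_of_mem hxb, norm_smul]
    refine (mul_le_mul (hB x) (hC x hx).2 (norm_nonneg _) (by positivity)).trans (le_of_eq ?_)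
    rw [mul_mul_mul_comm, ← Real.rpow_neg_one, ← Real.rpow_add (norm_pos_iff.2 hx)]
    norm_num
  · rw [hφ.singularVorticity_eq_zero (by simpa using hxb), indicator_of_notMem hxb]
    simp

end IsRadialCutoff

/-- The spatial part of the weak formulation vanishes for radial vorticities. -/
theorem integral_inner_gradient_velocity_mul {ω : Plane → ℝ} (hω : IsRadial ω)
    (hωm : AEStronglyMeasurable ω volume) (hint : Integrable fun x => ω x • velocity ω x)
    {χ : Plane → ℝ} (hχ : ContDiff ℝ 1 χ) {L : ℝ} (hL : ∀ x, ‖fderiv ℝ χ x‖ ≤ L) :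
    ∫ x, inner ℝ (∇ χ x) (velocity ω x) * ω x = 0 := by
  have hum := aestronglyMeasurable_velocity hωm
  have hL0 : 0 ≤ L := (norm_nonneg _).trans (hL 0)
  -- `b` is the vorticity times the angular velocity: `ω u = b x^⊥`, and `b` is rotation invariant.
  set b : Plane → ℝ := fun x => ω x * (inner ℝ (velocity ω x) (perp x) / ‖x‖ ^ 2) with hb
  have hbm : AEStronglyMeasurable b volume :=
    hωm.mul ((hum.inner continuous_perp.aestronglyMeasurable).mul
      ((measurable_norm.pow_const 2).inv.aestronglyMeasurable))
  have hbr : ∀ θ x, b (rotation θ x) = b x := fun θ x => by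
    have h1 := PerpEquivariant.velocity (σ := 1) (by simpa using perpEquivariant_rotation θ)
      (hω.map (rotation θ)) x
    have h2 := perpEquivariant_rotation θ x
    rw [Units.val_one, one_smul] at h1
    rw [one_smul] at h2
    simp only [hb, hω.map, h1, h2, LinearIsometryEquiv.norm_map, LinearIsometryEquiv.inner_map_map]
  have hbx : ∀ x, ‖b x‖ * ‖x‖ ≤ ‖ω x • velocity ω x‖ := fun x => by
    rw [hb, norm_smul, norm_mul, mul_assoc]
    gcongr
    by_cases hx : ‖x‖ = 0
    · rw [hx, mul_zero]; positivity
    · rw [norm_div, norm_pow, norm_norm]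
      have h1 := norm_inner_le_norm (𝕜 := ℝ) (velocity ω x) (perp x)
      rw [norm_perp] at h1
      have hx' : 0 < ‖x‖ := lt_of_le_of_ne (norm_nonneg _) (Ne.symm hx)
      rw [div_mul_eq_mul_div, div_le_iff₀ (by positivity)]
      nlinarith
  have hlip : ∀ x, ‖χ x - χ 0‖ ≤ L * ‖x‖ := fun x => by
    have := convex_univ.norm_image_sub_le_of_norm_fderiv_le (𝕜 := ℝ) (f := χ) (C := L)
      (fun x _ => hχ.differentiable one_ne_zero x) (fun x _ => hL x) (mem_univ 0) (mem_univ x)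
    simpa using this
  -- Differentiate `∫ b (χ ∘ rotation θ - χ 0)` at `θ = 0`. The integral is constant in `θ`, and its
  -- derivative is the integral sought. Only `b |x|` is controlled by `|ω u|`; subtracting `χ 0`
  -- supplies the missing factor `|x|`.
  have hd := hasDerivAt_integral_of_dominated_loc_of_deriv_le (𝕜 := ℝ) (μ := volume) (x₀ := 0)
    (s := univ) (F := fun θ x => b x * (χ (rotation θ x) - χ 0))
    (F' := fun θ x => b x * fderiv ℝ χ (rotation θ x) (perp (rotation θ x)))
    (bound := fun x => L * ‖ω x • velocity ω x‖) univ_mem (Eventually.of_forall fun θ => ?_) ?_ ?_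
    (Eventually.of_forall fun x θ _ => ?_) (hint.norm.const_mul L)
    (Eventually.of_forall fun x θ _ => ?_)
  · have hconst : ∀ θ, ∫ x, b x * (χ (rotation θ x) - χ 0) = ∫ x, b x * (χ x - χ 0) := fun θ => by
      rw [← ((rotation θ).measurePreserving).integral_comp
        (rotation θ).toHomeomorph.measurableEmbedding (fun x => b x * (χ x - χ 0))]
      simp only [hbr]
    have h0 := hd.2
    simp only [hconst] at h0
    have h1 := h0.unique (hasDerivAt_const (0 : ℝ) _)
    rw [← h1]
    refine integral_congr_ae (Eventually.of_forall fun x => ?_)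
    have hr : rotation 0 x = x := by simp [rotation_apply]
    simp only [hr, gradient, InnerProductSpace.toDual_symm_apply]
    conv_lhs => rw [velocity_eq_smul_perp (fun A => hω.map A) x]
    rw [map_smul, smul_eq_mul, hb]
    ring
  · exact hbm.mul ((hχ.continuous.comp (rotation θ).continuous).sub
      continuous_const).aestronglyMeasurable
  · refine (hint.norm.const_mul L).mono' (hbm.mul ((hχ.continuous.comp
      (rotation 0).continuous).sub continuous_const).aestronglyMeasurable)
      (Eventually.of_forall fun x => ?_)
    rw [norm_mul]
    have h1 := hlip (rotation 0 x)
    rw [LinearIsometryEquiv.norm_map] at h1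
    calc ‖b x‖ * ‖χ (rotation 0 x) - χ 0‖ ≤ ‖b x‖ * (L * ‖x‖) := by gcongr
      _ = L * (‖b x‖ * ‖x‖) := by ring
      _ ≤ _ := by gcongr; exact hbx x
  · exact hbm.mul (((hχ.continuous_fderiv one_ne_zero).comp (rotation 0).continuous).clm_apply
      (continuous_perp.comp (rotation 0).continuous)).aestronglyMeasurable
  · rw [norm_mul]
    calc ‖b x‖ * ‖fderiv ℝ χ (rotation θ x) (perp (rotation θ x))‖
        ≤ ‖b x‖ * (L * ‖x‖) := by
          gcongr
          refine ((fderiv ℝ χ (rotation θ x)).le_opNorm _).trans ?_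
          rw [norm_perp, LinearIsometryEquiv.norm_map]
          gcongr
          exact hL _
      _ = L * (‖b x‖ * ‖x‖) := by ring
      _ ≤ _ := by gcongr; exact hbx x
  · exact (((hχ.differentiable one_ne_zero _).hasFDerivAt.comp_hasDerivAt θ
      (hasDerivAt_rotation θ x)).sub_const _).const_mul _

/-! ### The weak solution of the Euler equations -/

theorem restrict_slab (T : ℝ) : (volume : Measure (ℝ × Plane)).restrict (slab T) =
    (volume.restrict (Ioo 0 T)).prod volume := by
  rw [slab, Measure.volume_eq_prod, ← Measure.prod_restrict, Measure.restrict_univ]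

theorem MemLp.memLinftyLp {F : Type*} [NormedAddCommGroup F] {p : ℝ≥0∞} {f : Plane → F}
    (hf : MemLp f p volume) (T : ℝ) : MemLinftyLp T p fun _ => f := by
  refine ⟨?_, (eLpNorm f p volume).toNNReal, Eventually.of_forall fun t => ?_⟩
  · rw [restrict_slab]
    exact hf.1.comp_snd
  · rw [ENNReal.coe_toNNReal hf.2.ne]

theorem hasDerivAt_fst {ψ : ℝ × Plane → ℝ} (hψ : ContDiff ℝ 1 ψ) (z : ℝ × Plane) :
    HasDerivAt (fun s => ψ (s, z.2)) (fderiv ℝ ψ z (1, 0)) z.1 := by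
  have h : HasDerivAt (fun s : ℝ => (s, z.2)) ((1 : ℝ), (0 : Plane)) z.1 :=
    (hasDerivAt_id _).prodMk (hasDerivAt_const _ _)
  exact (hψ.differentiable one_ne_zero z).hasFDerivAt.comp_hasDerivAt z.1 h

theorem inner_gradient_snd {ψ : ℝ × Plane → ℝ} (hψ : ContDiff ℝ 1 ψ) (z : ℝ × Plane) (v : Plane) :
    inner ℝ (∇ (fun y => ψ (z.1, y)) z.2) v = fderiv ℝ ψ z (0, v) := by
  have h : HasFDerivAt (fun y : Plane => (z.1, y)) (ContinuousLinearMap.inr ℝ ℝ Plane) z.2 :=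
    hasFDerivAt_prodMk_right z.1 z.2
  have h2 := (hψ.differentiable one_ne_zero z).hasFDerivAt.comp z.2 h
  rw [gradient, InnerProductSpace.toDual_symm_apply]
  have h3 : HasFDerivAt (fun y => ψ (z.1, y)) _ z.2 := h2
  rw [h3.fderiv]
  rfl

namespace IsRadialCutoff

variable {φ : Plane → ℝ}

theorem weak_form (hφ : IsRadialCutoff φ) {T : ℝ} (hT : 0 < T) {ψ : ℝ × Plane → ℝ}
    (hψ : ContDiff ℝ (⊤ : ℕ∞) ψ) (hc : HasCompactSupport ψ) (hs : tsupport ψ ⊆ Iio T ×ˢ univ) :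
    IntegrableOn (fun z : ℝ × Plane => deriv (fun s => ψ (s, z.2)) z.1 * singularVorticity φ z.2 +
      inner ℝ (∇ (fun y => ψ (z.1, y)) z.2) (velocity (singularVorticity φ) z.2) *
        singularVorticity φ z.2) (slab T) volume ∧
    (∫ z in slab T, (deriv (fun s => ψ (s, z.2)) z.1 * singularVorticity φ z.2 +
      inner ℝ (∇ (fun y => ψ (z.1, y)) z.2) (velocity (singularVorticity φ) z.2) *
        singularVorticity φ z.2)) + ∫ x, ψ (0, x) * singularVorticity φ x = 0 := by
  have hψ1 : ContDiff ℝ 1 ψ := hψ.of_le (by simp)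
  have hcf : Continuous (fderiv ℝ ψ) := hψ1.continuous_fderiv one_ne_zero
  obtain ⟨L, hL⟩ := (hc.fderiv ℝ).exists_bound_of_continuous hcf
  have hL0 : 0 ≤ L := (norm_nonneg _).trans (hL 0)
  have hi := hφ.integrable_singularVorticity
  have hu := hφ.aestronglyMeasurable_velocity_singularVorticity
  have hiu := hφ.integrable_smul_velocity
  have h1 : Integrable (fun z : ℝ × Plane => deriv (fun s => ψ (s, z.2)) z.1 *
      singularVorticity φ z.2) ((volume.restrict (Ioo 0 T)).prod volume) := by
    refine (hi.comp_snd _).bdd_mul (c := L * ‖((1 : ℝ), (0 : Plane))‖) ?_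
      (Eventually.of_forall fun z => ?_)
    · simp only [(hasDerivAt_fst hψ1 _).deriv]
      exact (hcf.clm_apply continuous_const).aestronglyMeasurable
    · rw [(hasDerivAt_fst hψ1 _).deriv]
      exact (ContinuousLinearMap.le_opNorm _ _).trans (by gcongr; exact hL z)
  have h2 : Integrable (fun z : ℝ × Plane => inner ℝ (∇ (fun y => ψ (z.1, y)) z.2)
      (velocity (singularVorticity φ) z.2) * singularVorticity φ z.2)
      ((volume.restrict (Ioo 0 T)).prod volume) := by
    simp only [inner_gradient_snd hψ1]
    refine ((hiu.comp_snd _).norm.const_mul L).mono' ?_ (Eventually.of_forall fun z => ?_)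
    · refine AEStronglyMeasurable.mul ?_ hi.1.comp_snd
      exact (ContinuousLinearMap.id ℝ (ℝ × Plane →L[ℝ] ℝ)).aestronglyMeasurable_comp₂
        hcf.aestronglyMeasurable (aestronglyMeasurable_const.prodMk hu.comp_snd)
    · rw [norm_mul, norm_smul, mul_comm ‖singularVorticity φ z.2‖, ← mul_assoc]
      gcongr
      refine (ContinuousLinearMap.le_opNorm _ _).trans ?_
      have : ‖((0 : ℝ), velocity (singularVorticity φ) z.2)‖ =
          ‖velocity (singularVorticity φ) z.2‖ := by
        rw [Prod.norm_def, norm_zero, max_eq_right (norm_nonneg _)]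
      rw [this]
      gcongr
      exact hL z
  rw [IntegrableOn, restrict_slab]
  refine ⟨h1.add h2, ?_⟩
  -- The time-derivative term is integrated in time first, yielding minus the initial term; the
  -- transport term is integrated in space first, where it vanishes for every `t`.
  rw [integral_add h1 h2, integral_prod_symm _ h1, integral_prod _ h2]
  have h3 : ∀ t, ∫ x, inner ℝ (∇ (fun y => ψ (t, y)) x) (velocity (singularVorticity φ) x) *
      singularVorticity φ x = 0 := fun t => by
    refine integral_inner_gradient_velocity_mul hφ.isRadial_singularVorticity hi.1 hiu
      (hψ1.comp (contDiff_const.prodMk contDiff_id)) (L := L) fun x => ?_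
    refine ContinuousLinearMap.opNorm_le_bound _ hL0 fun v => ?_
    have h := inner_gradient_snd hψ1 (t, x) v
    rw [gradient, InnerProductSpace.toDual_symm_apply] at h
    change ‖fderiv ℝ (fun y => ψ (t, y)) x v‖ ≤ _
    rw [h]
    refine (ContinuousLinearMap.le_opNorm _ _).trans ?_
    rw [Prod.norm_def, norm_zero, max_eq_right (norm_nonneg _)]
    gcongr
    exact hL _
  have h4 : ∀ x, ∫ t in Ioo 0 T, deriv (fun s => ψ (s, x)) t * singularVorticity φ x =
      -(ψ (0, x) * singularVorticity φ x) := fun x => by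
    rw [integral_mul_const, ← integral_Ioc_eq_integral_Ioo, ← intervalIntegral.integral_of_le hT.le]
    rw [intervalIntegral.integral_eq_sub_of_hasDerivAt (f := fun s => ψ (s, x))]
    · have : ψ (T, x) = 0 := image_eq_zero_of_notMem_tsupport fun h => lt_irrefl T (hs h).1
      rw [this]
      ring
    · intro t _
      have := hasDerivAt_fst hψ1 (t, x)
      rwa [← this.deriv] at this
    · refine Continuous.intervalIntegrable ?_ _ _
      have h5 : deriv (fun s => ψ (s, x)) = fun t => fderiv ℝ ψ (t, x) (1, 0) :=
        funext fun t => (hasDerivAt_fst hψ1 (t, x)).deriv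
      rw [h5]
      exact (hcf.comp (by fun_prop)).clm_apply continuous_const
  simp only [h3, h4, integral_zero, add_zero]
  rw [integral_neg, neg_add_cancel]

theorem isWeakEulerSolution (hφ : IsRadialCutoff φ) {p : ℝ≥0∞} (hp : 4 / 3 ≤ p) (hp2 : p < 2)
    {T : ℝ} (hT : 0 < T) :
    IsWeakEulerSolution T p (singularVorticity φ) fun _ => singularVorticity φ := by
  have hp1 : 1 ≤ p := by
    refine le_trans ?_ hp
    rw [ENNReal.le_div_iff_mul_le (by simp) (by simp), one_mul]
    norm_num
  have hLp := hφ.memLp_singularVorticity hp1 hp2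
  obtain ⟨C, -, hC⟩ := hφ.exists_velocity_bound
  refine ⟨hp, hLp, MemLp.memLinftyLp hLp T, ?_, ?_, fun ψ h1 h2 h3 => hφ.weak_form hT h1 h2 h3⟩
  · rw [restrict_slab]
    exact Measure.quasiMeasurePreserving_snd.ae
      (ae_ne_zero_plane.mono fun x hx => (hC x hx).1)
  · refine ⟨fun _ => (ball (0 : Plane) 1).indicator (velocity (singularVorticity φ)),
      fun _ => (ball (0 : Plane) 1)ᶜ.indicator (velocity (singularVorticity φ)),
      MemLp.memLinftyLp hφ.memLp_velocity_indicator T,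
      MemLp.memLinftyLp hφ.memLp_top_velocity_indicator T, Eventually.of_forall fun z => ?_⟩
    exact (congrFun (indicator_self_add_compl (ball (0 : Plane) 1) _) z.2).symm

/-! ### The viscous approximation -/

theorem isSmoothEvolution (hφ : IsRadialCutoff φ) {p : ℝ≥0∞} (hp : 1 ≤ p) (hp2 : p < 2)
    {ν : ℝ} (hν : 0 < ν) :
    IsSmoothEvolution p (singularVorticity φ) (heatEvolution (singularVorticity φ) ν) := by
  have hLp := hφ.memLp_singularVorticity hp hp2
  have hpt : p ≠ ∞ := (hp2.trans (by simp)).ne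
  have hsm : ContDiffOn ℝ (⊤ : ℕ∞) (fun z : ℝ × Plane =>
      heatEvolution (singularVorticity φ) ν z.1 z.2) (Ioi 0 ×ˢ univ) := by
    simp only [heatEvolution_eq]
    refine (contDiffOn_heatFlow hφ.integrable_singularVorticity
      hφ.hasCompactSupport_singularVorticity).comp (f := fun z : ℝ × Plane => (ν * z.1, z.2))
      (by fun_prop) fun z hz => ⟨?_, mem_univ _⟩
    have : 0 < z.1 := hz.1
    exact mul_pos hν this
  refine ⟨hsm, fun T hT => ⟨?_, (eLpNorm (singularVorticity φ) p volume).toNNReal, ?_⟩, ?_⟩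
  · refine ContinuousOn.aestronglyMeasurable (hsm.continuousOn.mono ?_)
      (measurableSet_Ioo.prod MeasurableSet.univ)
    exact prod_mono Ioo_subset_Ioi_self le_rfl
  · rw [ae_restrict_iff' measurableSet_Ioo]
    refine Eventually.of_forall fun t ht => ?_
    rw [ENNReal.coe_toNNReal hLp.2.ne, heatEvolution_eq]
    exact eLpNorm_heatFlow_le (mul_pos hν ht.1) hp hpt hLp.1
  · simp only [heatEvolution_eq]
    refine (tendsto_eLpNorm_heatFlow_sub hp hpt hLp hφ.integrable_singularVorticity).comp
      (f := fun t => ν * t) (tendsto_nhdsWithin_iff.2 ⟨?_, ?_⟩)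
    · have : Continuous fun t : ℝ => ν * t := by fun_prop
      simpa using (this.tendsto 0).mono_left nhdsWithin_le_nhds
    · filter_upwards [self_mem_nhdsWithin] with t ht using mul_pos hν ht

theorem hasDerivAt_heatEvolution (hφ : IsRadialCutoff φ) {ν t : ℝ} (hν : 0 < ν) (ht : 0 < t)
    (x : Plane) : HasDerivAt (fun s => heatEvolution (singularVorticity φ) ν s x)
      (ν * (Δ (heatEvolution (singularVorticity φ) ν t)) x) t := by
  simp only [heatEvolution_eq]
  have h := (deriv_heatFlow_eq_laplacian hφ.integrable_singularVorticity
    hφ.hasCompactSupport_singularVorticity (mul_pos hν ht) x).comp t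
    ((hasDerivAt_id t).const_mul ν)
  rw [mul_one, mul_comm] at h
  exact h

theorem isHeatSolution (hφ : IsRadialCutoff φ) {p : ℝ≥0∞} (hp : 1 ≤ p) (hp2 : p < 2)
    {ν : ℝ} (hν : 0 < ν) :
    IsHeatSolution ν p (singularVorticity φ) (heatEvolution (singularVorticity φ) ν) where
  toIsSmoothEvolution := hφ.isSmoothEvolution hp hp2 hν
  heat_eq := fun _ ht x => (hφ.hasDerivAt_heatEvolution hν ht x).deriv

theorem heatFlow_map (hφ : IsRadialCutoff φ) (s : ℝ) (A : Plane ≃ₗᵢ[ℝ] Plane) (x : Plane) :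
    heatFlow s (singularVorticity φ) (A x) = heatFlow s (singularVorticity φ) x :=
  convolution_map (.refl ℝ ℝ) ((isRadial_gaussKernel s).map A)
    (fun y => hφ.isRadial_singularVorticity.map A y) x

theorem norm_heatFlow_le (hφ : IsRadialCutoff φ) {s : ℝ} (hs : 0 < s) (x : Plane) :
    ‖heatFlow s (singularVorticity φ) x‖ ≤
      ∫ y, ‖singularVorticity φ y‖ * (4 * Real.pi * s)⁻¹ := by
  rw [heatFlow_apply_mul]
  refine norm_integral_le_of_norm_le (hφ.integrable_singularVorticity.norm.mul_const _)
    (Eventually.of_forall fun y => ?_)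
  rw [norm_mul, Real.norm_of_nonneg (gaussKernel_pos hs _).le]
  gcongr
  exact gaussKernel_le hs _

theorem integrable_heatFlow (hφ : IsRadialCutoff φ) {s : ℝ} (hs : 0 < s) :
    Integrable (heatFlow s (singularVorticity φ)) := by
  have hi := hφ.integrable_singularVorticity
  refine memLp_one_iff_integrable.1 ⟨(contDiff_heatFlow hi
    hφ.hasCompactSupport_singularVorticity hs).continuous.aestronglyMeasurable, ?_⟩
  exact (eLpNorm_heatFlow_le hs le_rfl (by simp) hi.1).trans_lt
    (memLp_one_iff_integrable.2 hi).2

theorem isNavierStokesSolution (hφ : IsRadialCutoff φ) {p : ℝ≥0∞} (hp : 1 ≤ p) (hp2 : p < 2)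
    {ν : ℝ} (hν : 0 < ν) :
    IsNavierStokesSolution ν p (singularVorticity φ)
      (heatEvolution (singularVorticity φ) ν) where
  toIsSmoothEvolution := hφ.isSmoothEvolution hp hp2 hν
  velocity_exists := fun t ht x => by
    rw [heatEvolution_eq]
    exact velocityExistsAt_of_bounded (hφ.integrable_heatFlow (mul_pos hν ht))
      (hφ.norm_heatFlow_le (mul_pos hν ht)) x
  navierStokes_eq := fun t ht x => by
    rw [(hφ.hasDerivAt_heatEvolution hν ht x).deriv, heatEvolution_eq,
      inner_velocity_gradient_eq_zero (hφ.heatFlow_map _), add_zero, sub_self]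

end IsRadialCutoff

/-- Hölder in space at almost every time, then the uniform bound in time. -/
theorem lintegral_slab_mul_le {T : ℝ} {p q : ℝ≥0∞} (hpq : p.HolderConjugate q)
    {f g : ℝ → Plane → ℝ}
    (hf : AEStronglyMeasurable (fun z : ℝ × Plane => f z.1 z.2) (volume.restrict (slab T)))
    (hg : AEStronglyMeasurable (fun z : ℝ × Plane => g z.1 z.2) (volume.restrict (slab T)))
    {C : ℝ≥0∞} (hC' : C ≠ ∞)
    (hC : ∀ᵐ t ∂(volume.restrict (Ioo 0 T)), eLpNorm (f t) p volume ≤ C) :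
    ∫⁻ z in slab T, ‖f z.1 z.2 * g z.1 z.2‖ₑ ≤ C * ∫⁻ t in Ioo 0 T, eLpNorm (g t) q volume := by
  rw [restrict_slab] at *
  have hfg : AEStronglyMeasurable (fun z : ℝ × Plane => f z.1 z.2 * g z.1 z.2)
    ((volume.restrict (Ioo 0 T)).prod volume) := hf.mul hg
  rw [lintegral_prod _ hfg.enorm]
  calc _ ≤ ∫⁻ t in Ioo 0 T, C * eLpNorm (g t) q volume := by
        refine lintegral_mono_ae ?_
        filter_upwards [hC, hf.prodMk_left, hg.prodMk_left] with t ht hft hgt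
        have := eLpNorm_smul_le_mul_eLpNorm (p := p) (q := q) (r := 1) hgt hft
        rw [eLpNorm_one_eq_lintegral_enorm] at this
        exact this.trans (by gcongr)
    _ = _ := lintegral_const_mul' _ _ hC'

namespace IsRadialCutoff

variable {φ : Plane → ℝ}

/-- The convergence is in fact strong in `L^p`, uniformly for `t` in `(0, T)`, because the flow
depends on `νt ≤ νT` only. -/
theorem tendstoWeakStar (hφ : IsRadialCutoff φ) {p : ℝ≥0∞} (hp : 1 ≤ p) (hp2 : p < 2)
    {T : ℝ} (hT : 0 < T) :
    TendstoWeakStar T p (heatEvolution (singularVorticity φ)) fun _ => singularVorticity φ := by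
  have hLp := hφ.memLp_singularVorticity hp hp2
  have hpt : p ≠ ∞ := (hp2.trans (by simp)).ne
  have hmem : ∀ ν : ℝ, 0 < ν → MemLinftyLp T p (heatEvolution (singularVorticity φ) ν) :=
    fun ν hν => (hφ.isSmoothEvolution hp hp2 hν).mem T hT
  have hmem0 := MemLp.memLinftyLp hLp T
  refine ⟨by filter_upwards [self_mem_nhdsWithin] with ν hν using hmem ν hν, hmem0,
    fun q hpq g hg hgi => ?_⟩
  have hint : ∀ f : ℝ → Plane → ℝ, MemLinftyLp T p f →
      Integrable (fun z : ℝ × Plane => f z.1 z.2 * g z.1 z.2) (volume.restrict (slab T)) :=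
    fun f ⟨hf, C, hC⟩ => ⟨hf.mul hg, (lintegral_slab_mul_le hpq hf hg ENNReal.coe_ne_top hC).trans_lt
      (ENNReal.mul_lt_top (by simp) hgi)⟩
  rw [tendsto_iff_edist_tendsto_0, ENNReal.tendsto_nhds_zero]
  intro ε hε
  by_cases hεt : ε = ∞
  · simp [hεt]
  set I := ∫⁻ t in Ioo 0 T, eLpNorm (g t) q volume with hI
  -- `I + 1` in place of `I` allows `I = 0`.
  have hε' : 0 < ε / (I + 1) := ENNReal.div_pos hε.ne' (by simp [hgi.ne])
  have hs := ENNReal.tendsto_nhds_zero.1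
    (tendsto_eLpNorm_heatFlow_sub hp hpt hLp hφ.integrable_singularVorticity) _ hε'
  rw [eventually_nhdsWithin_iff, Metric.eventually_nhds_iff] at hs
  obtain ⟨δ, hδ, hs⟩ := hs
  filter_upwards [Ioo_mem_nhdsGT (show 0 < δ / T by positivity)] with ν hν
  have h1 : ∀ᵐ t ∂(volume.restrict (Ioo 0 T)),
      eLpNorm (heatEvolution (singularVorticity φ) ν t - singularVorticity φ) p volume ≤
        ε / (I + 1) := by
    rw [ae_restrict_iff' measurableSet_Ioo]
    refine Eventually.of_forall fun t ht => ?_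
    have h2 : 0 < ν * t := mul_pos hν.1 ht.1
    rw [heatEvolution_eq]
    refine hs ?_ h2
    rw [Real.dist_eq, sub_zero, abs_of_pos h2]
    calc ν * t < δ / T * T := by
          have := hν.1
          have := hν.2
          have := ht.1
          have := ht.2
          gcongr
      _ = δ := by field_simp
  have h3 := lintegral_slab_mul_le hpq (f := fun t => heatEvolution (singularVorticity φ) ν t -
    singularVorticity φ) ((hmem ν hν.1).1.sub hmem0.1) hg
    (ENNReal.div_ne_top hεt (by simp)) h1
  rw [edist_eq_enorm_sub, ← integral_sub (hint _ (hmem ν hν.1)) (hint _ hmem0)]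
  refine (enorm_integral_le_lintegral_enorm _).trans ?_
  simp only [← sub_mul]
  refine h3.trans ?_
  calc ε / (I + 1) * I ≤ ε / (I + 1) * (I + 1) := by gcongr; exact le_self_add
    _ = ε := ENNReal.div_mul_cancel (by simp) (by simp [hgi.ne])

end IsRadialCutoff

/-! ### The enstrophy defects -/

namespace IsRadialCutoff

variable {φ : Plane → ℝ}

/-- Source of the factor `1/t` in the defect: viscosity `ν` at time `t` is unit viscosity at time
`νt`, and `ν = t⁻¹ (νt)`. -/
theorem viscousDensity_heatEvolution (f : Plane → ℝ) (ν : ℝ) {t : ℝ} (ht : 0 < t) (x : Plane) :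
    viscousDensity ν (heatEvolution f ν t) x =
      t⁻¹ * viscousDensity (ν * t) (heatFlow (ν * t) f) x := by
  rw [heatEvolution_eq, viscousDensity, viscousDensity]
  field_simp

theorem tendsto_mul_const_nhdsGT_zero {t : ℝ} (ht : 0 < t) :
    Tendsto (fun ν : ℝ => ν * t) (𝓝[>] 0) (𝓝[>] 0) := by
  refine tendsto_nhdsWithin_iff.2 ⟨?_, ?_⟩
  · have : Continuous fun ν : ℝ => ν * t := by fun_prop
    simpa using (this.tendsto 0).mono_left nhdsWithin_le_nhds
  · filter_upwards [self_mem_nhdsWithin] with ν hν using mul_pos hν ht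

theorem tendsto_integral_viscousDensity_heatEvolution (hφ : IsRadialCutoff φ) {t : ℝ} (ht : 0 < t)
    {ψ : Plane → ℝ} (hψ : Continuous ψ) {B : ℝ} (hB : ∀ x, ‖ψ x‖ ≤ B) :
    Tendsto (fun ν => ∫ x, viscousDensity ν (heatEvolution (singularVorticity φ) ν t) x * ψ x)
      (𝓝[>] 0) (𝓝 (Real.pi / (2 * t) * ψ 0)) := by
  simp only [viscousDensity_heatEvolution _ _ ht, mul_assoc, integral_const_mul]
  have h := ((hφ.tendsto_integral_viscousDensity_mul hψ hB).comp
    (tendsto_mul_const_nhdsGT_zero ht)).const_mul t⁻¹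
  have e : t⁻¹ * (Real.pi / 2 * ψ 0) = Real.pi / (2 * t) * ψ 0 := by field_simp
  rw [e] at h
  exact h

theorem continuousOn_viscousDensity (hφ : IsRadialCutoff φ) {ν : ℝ} (hν : 0 < ν) :
    ContinuousOn (fun z : ℝ × Plane =>
      viscousDensity ν (heatEvolution (singularVorticity φ) ν z.1) z.2) (Ioi 0 ×ˢ univ) := by
  have hopen : IsOpen (Ioi 0 ×ˢ univ : Set (ℝ × Plane)) := isOpen_Ioi.prod isOpen_univ
  have hsm := (hφ.isSmoothEvolution le_rfl (by simp) hν).smooth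
  have hc := hsm.continuousOn_fderiv_of_isOpen hopen (by simp)
  have hc2 := (((ContinuousLinearMap.compL ℝ Plane (ℝ × Plane) ℝ).flip
    (ContinuousLinearMap.inr ℝ ℝ Plane)).continuous.comp_continuousOn hc).norm.pow 2
  refine (hc2.const_smul ν).congr fun z hz => ?_
  have h : HasFDerivAt (fun y : Plane => (z.1, y)) (ContinuousLinearMap.inr ℝ ℝ Plane) z.2 :=
    hasFDerivAt_prodMk_right z.1 z.2
  have hd := ((hsm.differentiableOn (by simp)).differentiableAt (hopen.mem_nhds hz)).hasFDerivAt
  have h3 := (HasFDerivAt.comp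
    (g := fun z : ℝ × Plane => heatEvolution (singularVorticity φ) ν z.1 z.2)
    (f := fun y : Plane => (z.1, y)) z.2 hd h).fderiv
  change fderiv ℝ (heatEvolution (singularVorticity φ) ν z.1) z.2 = _ at h3
  rw [viscousDensity, norm_gradient, h3]
  rfl

theorem locallyIntegrableOn_viscousDensity (hφ : IsRadialCutoff φ) {ν : ℝ} (hν : 0 < ν) :
    LocallyIntegrableOn (fun z : ℝ × Plane =>
      viscousDensity ν (heatEvolution (singularVorticity φ) ν z.1) z.2) spaceTime volume :=
  (hφ.continuousOn_viscousDensity hν).locallyIntegrableOn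
    (isOpen_Ioi.prod isOpen_univ).measurableSet

theorem isTransportDefect (hφ : IsRadialCutoff φ) {j : Plane → ℝ} (hj : IsRadialMollifier j) :
    IsTransportDefect j (fun _ => singularVorticity φ) 0 := by
  have h : ∀ ε x, transportDensity j ε (singularVorticity φ) x = 0 :=
    transportDensity_eq_zero hj.radial hφ.isRadial_singularVorticity
  refine ⟨Eventually.of_forall fun ε => ?_, fun ψ => ?_⟩
  · simp only [h]
    exact continuousOn_const.locallyIntegrableOn (isOpen_Ioi.prod isOpen_univ).measurableSet
  · simp only [h, zero_mul, integral_zero]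
    exact tendsto_const_nhds

end IsRadialCutoff

/-- The time axis in space-time. -/
def timeAxis (t : ℝ) : ℝ × Plane := (t, 0)

theorem isClosedEmbedding_timeAxis : IsClosedEmbedding timeAxis :=
  (Isometry.of_dist_eq fun s t => by simp [timeAxis, Prod.dist_eq]).isClosedEmbedding

/-- Compact subsets of the open half-space stay away from `t = 0`, where the density is singular. -/
theorem locallyIntegrableOn_timeAxis :
    LocallyIntegrableOn (fun z : ℝ × Plane => Real.pi / (2 * z.1)) spaceTime
      ((volume : Measure ℝ).map timeAxis) := by
  rw [locallyIntegrableOn_iff spaceTime.isOpen.isLocallyClosed]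
  intro K hK hKc
  rw [isClosedEmbedding_timeAxis.measurableEmbedding.integrableOn_map_iff]
  refine ContinuousOn.integrableOn_compact (isClosedEmbedding_timeAxis.isCompact_preimage hKc) ?_
  refine continuousOn_const.div (by simp only [timeAxis]; fun_prop) fun t ht => ?_
  have h : (0 : ℝ) < (timeAxis t).1 := (hK ht).1
  positivity

/-- The distribution `π / (2t) δ₀` on `(0, ∞) × ℝ²`. -/
def diracAxis : 𝓓'(spaceTime, ℝ) :=
  TestFunction.integralAgainstBilinCLM (ContinuousLinearMap.mul ℝ ℝ)
    ((volume : Measure ℝ).map timeAxis) fun z => Real.pi / (2 * z.1)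

theorem testFunction_eq_zero (ψ : 𝓓(spaceTime, ℝ)) {t : ℝ} (ht : t ≤ 0) (x : Plane) :
    ψ (t, x) = 0 :=
  image_eq_zero_of_notMem_tsupport fun h => not_lt.2 ht (ψ.tsupport_subset h).1

theorem integrableOn_timeAxis (ψ : 𝓓(spaceTime, ℝ)) :
    IntegrableOn (fun t : ℝ => Real.pi / (2 * t) * ψ (t, 0)) (Ioi 0) volume := by
  have h := ψ.integrable_bilin (ContinuousLinearMap.mul ℝ ℝ) locallyIntegrableOn_timeAxis
  rw [isClosedEmbedding_timeAxis.measurableEmbedding.integrable_map_iff] at h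
  refine (h.congr (Eventually.of_forall fun t => ?_)).integrableOn
  exact mul_comm _ _

theorem diracAxis_apply (ψ : 𝓓(spaceTime, ℝ)) :
    diracAxis ψ = ∫ t in Ioi (0 : ℝ), Real.pi / (2 * t) * ψ (t, 0) := by
  have h : diracAxis ψ = ∫ z, ContinuousLinearMap.mul ℝ ℝ (ψ z) (Real.pi / (2 * z.1))
      ∂((volume : Measure ℝ).map timeAxis) :=
    TestFunction.integralAgainstBilinCLM_eq_integral locallyIntegrableOn_timeAxis
  rw [h, isClosedEmbedding_timeAxis.measurableEmbedding.integral_map,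
    setIntegral_eq_integral_of_forall_compl_eq_zero]
  · exact integral_congr_ae (Eventually.of_forall fun t => mul_comm _ _)
  · intro t ht
    rw [testFunction_eq_zero ψ (not_lt.1 ht), mul_zero]

/-- Tested on a bump centred at `(1, 0)`, whose radius `1/2` keeps its support in `t > 0`. -/
theorem diracAxis_ne_zero : diracAxis ≠ 0 := by
  let f : ContDiffBump ((1 : ℝ), (0 : Plane)) := ⟨1 / 4, 1 / 2, by norm_num, by norm_num⟩
  have hsub : tsupport f ⊆ spaceTime := by
    rw [f.tsupport_eq]
    rintro ⟨t, x⟩ hz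
    rw [mem_closedBall, Prod.dist_eq, max_le_iff, Real.dist_eq] at hz
    have := (abs_le.1 hz.1).1
    exact ⟨by change (0 : ℝ) < t; norm_num [f] at this; linarith, mem_univ _⟩
  let ψ : 𝓓(spaceTime, ℝ) := ⟨f, f.contDiff, f.hasCompactSupport, hsub⟩
  intro h0
  have h1 : diracAxis ψ = 0 := by rw [h0]; rfl
  rw [diracAxis_apply] at h1
  have hpos : 0 < ∫ t in Ioi (0 : ℝ), Real.pi / (2 * t) * ψ (t, 0) := by
    rw [setIntegral_pos_iff_support_of_nonneg_ae _ (integrableOn_timeAxis ψ)]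
    · refine lt_of_lt_of_le ?_ (measure_mono (?_ : Ioo (3 / 4 : ℝ) (5 / 4) ⊆ _))
      · rw [Real.volume_Ioo]; norm_num
      · intro t ht
        have ht0 : 0 < t := by linarith [ht.1]
        refine ⟨?_, ht0⟩
        have hf : 0 < f (t, 0) := f.pos_of_mem_ball (by
          rw [mem_ball, Prod.dist_eq, dist_self, max_lt_iff, Real.dist_eq, abs_lt]
          change (-(1 / 2) < t - 1 ∧ t - 1 < 1 / 2) ∧ (0 : ℝ) < 1 / 2
          refine ⟨⟨?_, ?_⟩, ?_⟩ <;> linarith [ht.1, ht.2])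
        have hpi := Real.pi_pos
        have : 0 < Real.pi / (2 * t) * f (t, 0) := by positivity
        exact this.ne'
    · rw [EventuallyLE, ae_restrict_iff' measurableSet_Ioi]
      refine Eventually.of_forall fun t ht => ?_
      have ht0 : (0 : ℝ) < t := ht
      have hpi := Real.pi_pos
      exact mul_nonneg (by positivity) f.nonneg
  exact hpos.ne' h1

namespace IsRadialCutoff

variable {φ : Plane → ℝ}

/-- Fubini reduces to the limit at each fixed `t`. The time projection `K` of the support is compact
in `(0, ∞)`, so `C M / t` on `K` is an integrable dominating function. -/
theorem isViscousDefect (hφ : IsRadialCutoff φ) :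
    IsViscousDefect (heatEvolution (singularVorticity φ)) diracAxis := by
  refine ⟨by filter_upwards [self_mem_nhdsWithin] with ν hν
              using hφ.locallyIntegrableOn_viscousDensity hν, fun ψ => ?_⟩
  rw [diracAxis_apply]
  obtain ⟨M, hM⟩ := ψ.hasCompactSupport.exists_bound_of_continuous ψ.continuous
  have hM0 : 0 ≤ M := (norm_nonneg _).trans (hM 0)
  set K : Set ℝ := Prod.fst '' tsupport ψ with hK
  have hKc : IsCompact K := ψ.hasCompactSupport.isCompact.image continuous_fst
  have hKpos : ∀ t ∈ K, 0 < t := by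
    rintro t ⟨z, hz, rfl⟩
    exact (ψ.tsupport_subset hz).1
  have hψK : ∀ t ∉ K, ∀ x, ψ (t, x) = 0 := fun t ht x =>
    image_eq_zero_of_notMem_tsupport fun h => ht ⟨_, h, rfl⟩
  obtain ⟨S, hS0, hS⟩ := hKc.isBounded.exists_pos_norm_le
  obtain ⟨C, hC⟩ := hφ.exists_integral_viscousDensity_le S
  have hint : ∀ ν : ℝ, 0 < ν → Integrable (fun z : ℝ × Plane =>
      viscousDensity ν (heatEvolution (singularVorticity φ) ν z.1) z.2 * ψ z)
      ((volume.restrict (Ioi 0)).prod volume) := fun ν hν => by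
    have h := ψ.integrable_bilin (ContinuousLinearMap.mul ℝ ℝ)
      (hφ.locallyIntegrableOn_viscousDensity hν)
    have h2 := h.restrict (s := Ioi 0 ×ˢ univ)
    rw [Measure.volume_eq_prod, ← Measure.prod_restrict, Measure.restrict_univ] at h2
    exact h2.congr (Eventually.of_forall fun z => mul_comm _ _)
  have hset : (volume : Measure (ℝ × Plane)).restrict (spaceTime : Set (ℝ × Plane)) =
      (volume.restrict (Ioi 0)).prod volume := by
    change volume.restrict (Ioi 0 ×ˢ univ) = _
    rw [Measure.volume_eq_prod, ← Measure.prod_restrict, Measure.restrict_univ]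
  rw [hset]
  have hlim : Tendsto (fun ν => ∫ t in Ioi (0 : ℝ), ∫ x,
      viscousDensity ν (heatEvolution (singularVorticity φ) ν t) x * ψ (t, x)) (𝓝[>] 0)
      (𝓝 (∫ t in Ioi (0 : ℝ), Real.pi / (2 * t) * ψ (t, 0))) := by
    refine tendsto_integral_filter_of_dominated_convergence
      (K.indicator fun t => t⁻¹ * (C * M)) ?_ ?_ ?_ ?_
    · filter_upwards [self_mem_nhdsWithin] with ν hν using (hint ν hν).integral_prod_left.1
    -- Taking `ν < 1` keeps `νt ≤ S` for all `t` in `K`, so the single mass bound `C` applies.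
    · filter_upwards [Ioo_mem_nhdsGT one_pos] with ν hν
      refine Eventually.of_forall fun t => ?_
      by_cases ht : t ∈ K
      · have ht0 := hKpos t ht
        have hνt := mul_pos hν.1 ht0
        have hle : ν * t ≤ S := by
          have := (le_abs_self t).trans (hS t ht)
          nlinarith [hν.1, hν.2]
        rw [indicator_of_mem ht]
        simp only [viscousDensity_heatEvolution _ _ ht0, mul_assoc, integral_const_mul]
        rw [norm_mul, Real.norm_of_nonneg (by positivity)]
        gcongr
        refine (norm_integral_le_of_norm_le ((hφ.integrable_viscousDensity hνt).mul_const M)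
          (Eventually.of_forall fun x => ?_)).trans ?_
        · rw [norm_mul, Real.norm_of_nonneg (viscousDensity_nonneg hνt.le _ _)]
          exact mul_le_mul_of_nonneg_left (hM _) (viscousDensity_nonneg hνt.le _ _)
        · rw [integral_mul_const]
          exact mul_le_mul_of_nonneg_right (hC _ hνt hle) hM0
      · simp [hψK t ht, indicator_of_notMem ht]
    · refine Integrable.restrict ?_
      rw [integrable_indicator_iff hKc.measurableSet]
      refine ContinuousOn.integrableOn_compact hKc (ContinuousOn.mul ?_ continuousOn_const)
      exact continuousOn_id.inv₀ fun t ht => (hKpos t ht).ne'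
    · rw [ae_restrict_iff' measurableSet_Ioi]
      refine Eventually.of_forall fun t ht => ?_
      exact hφ.tendsto_integral_viscousDensity_heatEvolution ht
        (ψ := fun x => ψ (t, x)) (ψ.continuous.comp (by fun_prop)) fun x => hM _
  refine hlim.congr' ?_
  filter_upwards [self_mem_nhdsWithin] with ν hν
  exact (integral_prod _ (hint ν hν)).symm

theorem tendstoDistribution_viscousDensity (hφ : IsRadialCutoff φ) {t : ℝ} (ht : 0 < t) :
    TendstoDistribution (⊤ : Opens Plane)
      (fun (ν : ℝ) x => viscousDensity ν (heatEvolution (singularVorticity φ) ν t) x)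
      (𝓝[>] 0) ((Real.pi / (2 * t)) • Distribution.delta (0 : Plane)) := by
  refine ⟨?_, fun ψ => ?_⟩
  · filter_upwards [self_mem_nhdsWithin] with ν hν
    simp only [viscousDensity_heatEvolution _ _ ht]
    exact ((hφ.integrable_viscousDensity (mul_pos hν ht)).const_mul
      _).locallyIntegrable.locallyIntegrableOn _
  · obtain ⟨M, hM⟩ := ψ.hasCompactSupport.exists_bound_of_continuous ψ.continuous
    have h := hφ.tendsto_integral_viscousDensity_heatEvolution ht ψ.continuous hM
    rw [Opens.coe_top, Measure.restrict_univ]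
    exact h

theorem tendsto_eLpNorm_viscousDensity (hφ : IsRadialCutoff φ) {t : ℝ} (ht : 0 < t) :
    Tendsto (fun ν : ℝ =>
        eLpNorm (viscousDensity ν (heatEvolution (singularVorticity φ) ν t)) 1 volume)
      (𝓝[>] 0) (𝓝 (ENNReal.ofReal (Real.pi / (2 * t)))) := by
  -- The density is nonnegative, so its `L¹` norm is its integral against the constant test function
  -- `1`.
  have h := hφ.tendsto_integral_viscousDensity_heatEvolution ht
    (ψ := fun _ => 1) continuous_const (B := 1) (fun x => by simp)
  simp only [mul_one] at h
  refine (ENNReal.tendsto_ofReal h).congr' ?_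
  filter_upwards [self_mem_nhdsWithin] with ν hν
  have hν0 : (0 : ℝ) < ν := hν
  have hi : Integrable (viscousDensity ν (heatEvolution (singularVorticity φ) ν t)) :=
    ((hφ.integrable_viscousDensity (mul_pos hν0 ht)).const_mul t⁻¹).congr
      (Eventually.of_forall fun x => (viscousDensity_heatEvolution _ _ ht x).symm)
  rw [ofReal_integral_eq_lintegral_ofReal hi
    (Eventually.of_forall fun x => viscousDensity_nonneg hν0.le _ x), eLpNorm_one_eq_lintegral_enorm]
  refine lintegral_congr fun x => ?_
  rw [← ofReal_norm, Real.norm_of_nonneg (viscousDensity_nonneg hν0.le _ x)]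

end IsRadialCutoff

end EnstrophyDefect

end

open EnstrophyDefect

theorem theorem6p1 (φ : Plane → ℝ) (hφ_smooth : ContDiff ℝ (⊤ : ℕ∞) φ)
    (hφ_radial : ∀ x y : Plane, ‖x‖ = ‖y‖ → φ x = φ y)
    (hφ_supp : tsupport φ ⊆ ball 0 1)
    (hφ_one : ∀ x ∈ ball (0 : Plane) (1 / 2), φ x = 1) :
    (∀ p : ℝ≥0∞, 4 / 3 ≤ p → p < 2 →
      (∀ ν : ℝ, 0 < ν →
        IsHeatSolution ν p (singularVorticity φ) (heatEvolution (singularVorticity φ) ν)) ∧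
      ∀ T : ℝ, 0 < T →
        IsViscositySolution T p (singularVorticity φ)
          (heatEvolution (singularVorticity φ)) (fun _ => singularVorticity φ)) ∧
    (∃ ZT ZV : 𝓓'(spaceTime, ℝ),
      (∀ j : Plane → ℝ, IsRadialMollifier j →
        IsTransportDefect j (fun _ => singularVorticity φ) ZT) ∧
      IsViscousDefect (heatEvolution (singularVorticity φ)) ZV ∧
      ZT = 0 ∧
      (∀ ψ : 𝓓(spaceTime, ℝ),
        IntegrableOn (fun t : ℝ => Real.pi / (2 * t) * ψ (t, 0)) (Ioi 0) volume ∧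
        ZV ψ = ∫ t in Ioi (0 : ℝ), Real.pi / (2 * t) * ψ (t, 0)) ∧
      ZT ≠ ZV) ∧
    (∀ t : ℝ, 0 < t →
      TendstoDistribution (⊤ : Opens Plane)
        (fun (ν : ℝ) x => viscousDensity ν (heatEvolution (singularVorticity φ) ν t) x)
        (𝓝[>] 0) ((Real.pi / (2 * t)) • Distribution.delta (0 : Plane))) ∧
    ∀ t : ℝ, 0 < t →
      Tendsto (fun ν : ℝ =>
          eLpNorm (viscousDensity ν (heatEvolution (singularVorticity φ) ν t)) 1 volume)
        (𝓝[>] 0) (𝓝 (ENNReal.ofReal (Real.pi / (2 * t)))) := by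
  have hφ : IsRadialCutoff φ := ⟨hφ_smooth, hφ_radial, hφ_supp, hφ_one⟩
  refine ⟨fun p hp hp2 => ?_, ⟨0, diracAxis, fun j hj => hφ.isTransportDefect hj,
    hφ.isViscousDefect, rfl, fun ψ => ⟨integrableOn_timeAxis ψ, diracAxis_apply ψ⟩,
    diracAxis_ne_zero.symm⟩, fun t ht => hφ.tendstoDistribution_viscousDensity ht,
    fun t ht => hφ.tendsto_eLpNorm_viscousDensity ht⟩
  have hp1 : 1 ≤ p := by
    refine le_trans ?_ hp
    rw [ENNReal.le_div_iff_mul_le (by simp) (by simp), one_mul]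
    norm_num
  exact ⟨fun ν hν => hφ.isHeatSolution hp1 hp2 hν, fun T hT =>
    ⟨hφ.isWeakEulerSolution hp hp2 hT, fun ν hν => hφ.isNavierStokesSolution hp1 hp2 hν,
      hφ.tendstoWeakStar hp1 hp2 hT⟩⟩
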